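/- Consider $M$ secondary users (SUs) and a virtual user $m=0$ with zero power, zero rate and zero interference, sharing $K$ bands, band $k$ being licensed to one primary user (PU). At time $n$ the channel state $\mathbf h[n]$ consists of the PU activities $a_k[n]\in\{0,1\}$, the SU-to-PU power gains $h_{k,1}^m[n]\ge 0$ and the SU-to-access-point power gains $h_{k,2}^m[n]\ge 0$; the process $\mathbf h$ is stationary and ergodic. Let $r_2(x)=\log_2(1+x)$ and $r_{k,1}(x)=\log_2\!\big(1+\frac{\gamma_k}{1+x}\big)$ with $\gamma_k\ge 0$, let $\beta^m>0$ be weights, and let $\check p_{k}^m(\mathbf h)$ be peak powers: nonnegative measurable functions of the channel state bounded by constants, with $\mathbb E[r_2(h_{k,2}^m\check p_k^m(\mathbf h))]<\infty$. Let $\bar c_2^*$ be the supremum of $\sum_{k,m}\mathbb E[\beta^m w_k^m r_2(h_{k,2}^m p_k^m)]$ over all measurable policies $\mathbf h\mapsto (w_k^m(\mathbf h),p_k^m(\mathbf h))$ with $w_k^m\in\{0,1\}$, $\sum_{m=0}^M w_k^m=1$, $0\le p_k^m\le\check p_k^m(\mathbf h)$ which satisfy the long-term constraints $$\mathbb E\Big[\sum_k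 w_k^m p_k^m\Big]\le\check p^m,\qquad \mathbb E\Big[a_k\sum_m w_k^m h_{k,1}^m p_k^m\Big]\le \mathbb E[a_k]\,\check p_{k,1},\qquad \mathbb E\Big[a_k\sum_m w_k^m r_{k,1}(h_{k,1}^m p_k^m)\Big]\ge \mathbb E[a_k]\,\check r_{k,1}$$ for all $m\ge 1$ and all $k$ (the last two are the constraints on the conditional expectations given $a_k=1$). Assume that this problem is feasible. Given multipliers $\pi^m[n],\theta_k[n],\rho_k[n]\ge 0$, put $$\varphi_k^m(p)=\beta^m r_2(h_{k,2}^m[n]p)-\pi^m[n]p-\theta_k[n]a_k[n]h_{k,1}^m[n]p+\rho_k[n]a_k[n]r_{k,1}(h_{k,1}^m[n]p),$$ with $\varphi_k^0=\rho_k[n]a_k[n]r_{k,1}(0)$ for the virtual user. Let $p_k^m[n]$ be a maximizer of $\varphi_k^m$ over $[0,\check p_k^m(\mathbf h[n])]$, and schedule in band $k$ (that is, $w_k^m[n]=1$, and $w_k^l[n]=0$ for $l\ne m$) one user $m$ that maximizes $\varphi_k^m(p_k^m[n])$ and satisfies $p_k^m[n]>0$ or $m=0$ (ties are broken arbitrarily).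 Update, from any nonnegative initial values and with constant stepsizes $\eta_\pi,\eta_\theta,\eta_\rho>0$ and $[x]_+=\max\{x,0\}$, $$\pi^m[n+1]=\Big[\pi^m[n]-\eta_\pi\Big(\check p^m-\sum_k w_k^m[n]p_k^m[n]\Big)\Big]_+,\qquad \theta_k[n+1]=\Big[\theta_k[n]-\eta_\theta a_k[n]\Big(\check p_{k,1}-\sum_m w_k^m[n]h_{k,1}^m[n]p_k^m[n]\Big)\Big]_+,$$ $$\rho_k[n+1]=\Big[\rho_k[n]+\eta_\rho a_k[n]\Big(\check r_{k,1}-\sum_m w_k^m[n]r_{k,1}(h_{k,1}^m[n]p_k^m[n])\Big)\Big]_+ .$$ Let $\eta=\max\{\eta_\pi,\eta_\theta,\eta_\rho\}$. Then for every constant $G$ there is a function $\Delta$ with $\Delta(\eta)\to 0$ as $\eta\downarrow 0$ such that, for all stepsizes and every run of the algorithm whose update terms (the terms multiplied by the stepsizes) are bounded by $G$ in absolute value, the following holds with probability one. i) For all $m\ge1$ and all $k$, $$\limsup_{n\to\infty}\frac1n\sum_{l=1}^{n}\sum_k w_k^m[l]p_k^m[l]\le\check p^m,\qquad \limsup_{n\to\infty}\frac1n\sum_{l=1}^{n}a_k[l]\sum_m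 w_k^m[l]h_{k,1}^m[l]p_k^m[l]\le\mathbb E[a_k]\,\check p_{k,1},$$ $$\liminf_{n\to\infty}\frac1n\sum_{l=1}^{n}a_k[l]\sum_m w_k^m[l]r_{k,1}(h_{k,1}^m[l]p_k^m[l])\ge\mathbb E[a_k]\,\check r_{k,1}.$$ ii) $$\liminf_{n\to\infty}\frac1n\sum_{l=1}^{n}\sum_{k,m}\beta^m w_k^m[l]\,r_2(h_{k,2}^m[l]p_k^m[l])\ge\bar c_2^*-\Delta(\eta).$$ -/

import Mathlib

open MeasureTheory Filter Topology
open scoped NNReal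

noncomputable section

namespace CognitiveRadio

/-- Channel state information for `K` bands and `M` secondary users: the activity `a_{k,1}` of the
primary users, the SU-to-PU power gains `h_{k,1}^m` and the SU-to-AP power gains `h_{k,2}^m`. -/
abbrev CSI (K M : ℕ) : Type :=
  (Fin K → Bool) × (Fin K → Fin M → ℝ≥0) × (Fin K → Fin M → ℝ≥0)

/-- `a_{k,1}` as a real number in `{0, 1}`. -/
def activity {K M : ℕ} (h : CSI K M) (k : Fin K) : ℝ := if h.1 k = true then 1 else 0

/-- The gain `h_{k,1}^m` between the `m`th SU and the `k`th PU. -/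
def gainPU {K M : ℕ} (h : CSI K M) (k : Fin K) (m : Fin M) : ℝ := (h.2.1 k m : ℝ)

/-- The gain `h_{k,2}^m` between the `m`th SU and the access point in band `k`. -/
def gainSU {K M : ℕ} (h : CSI K M) (k : Fin K) (m : Fin M) : ℝ := (h.2.2 k m : ℝ)

/-- The users competing for a band are the `M` secondary users together with a virtual user
(`none`), all of whose quantities (power, gains, weight, price) are zero. -/
def withVirtual {M : ℕ} (x : Fin M → ℝ) : Option (Fin M) → ℝ
  | none => 0
  | some m => x m

/-- The fixed parameters of the network. -/
structure Network (K M : ℕ) where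
  /-- priority weights `β^m` of the SUs -/
  β : Fin M → ℝ
  β_pos : ∀ m, 0 < β m
  /-- interference-free signal-to-noise ratios of the PUs -/
  γ : Fin K → ℝ
  γ_nonneg : ∀ k, 0 ≤ γ k
  /-- maximum average power of each SU -/
  maxAvgPower : Fin M → ℝ
  /-- maximum average interference power at each active PU -/
  maxInterf : Fin K → ℝ
  /-- minimum average rate of each active PU -/
  minRate : Fin K → ℝ
  /-- amplifier limits -/
  ampMax : Fin K → Fin M → ℝ
  /-- instantaneous peak power: any measurable function of the CSI between zero and the amplifier
  limit (in particular, the bounds which encode short-term interference or rate constraints) -/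
  peak : CSI K M → Fin K → Fin M → ℝ
  measurable_peak : ∀ k m, Measurable fun h => peak h k m
  peak_nonneg : ∀ h k m, 0 ≤ peak h k m
  peak_le : ∀ h k m, peak h k m ≤ ampMax k m

/-- An instantaneous resource allocation: scheduling variables `w` (virtual user included) and
powers `p` of the SUs. -/
structure Allocation (K M : ℕ) where
  w : Fin K → Option (Fin M) → ℝ
  p : Fin K → Fin M → ℝ

/-- Lagrange multipliers `π^m`, `θ_k`, `ρ_k`. -/
structure Multipliers (K M : ℕ) where
  pi : Fin M → ℝ
  theta : Fin K → ℝ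
  rho : Fin K → ℝ

/-- The SU rate-power function `x ↦ log₂ (1 + x)`. -/
def rateSU (x : ℝ) : ℝ := Real.logb 2 (1 + x)

namespace Network

variable {K M : ℕ} (S : Network K M)

/-- The rate of the `k`th PU under interference power `x`. -/
def ratePU (k : Fin K) (x : ℝ) : ℝ := Real.logb 2 (1 + S.γ k / (1 + x))

/-- Instantaneous power spent by the `m`th SU, `∑ k, w_{k,2}^m p_{k,2}^m`. -/
def usedPower (x : Allocation K M) (m : Fin M) : ℝ := ∑ k, x.w k (some m) * x.p k m

/-- `∑ m, w_{k,2}^m h_{k,1}^m p_{k,2}^m`. -/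
def interference (h : CSI K M) (x : Allocation K M) (k : Fin K) : ℝ :=
  ∑ m, x.w k m * (withVirtual (gainPU h k) m * withVirtual (x.p k) m)

/-- `∑ m, w_{k,2}^m r_{k,1}(h_{k,1}^m p_{k,2}^m)`; the virtual user contributes `r_{k,1}(0)` when it
is scheduled. -/
def primaryRate (h : CSI K M) (x : Allocation K M) (k : Fin K) : ℝ :=
  ∑ m, x.w k m * S.ratePU k (withVirtual (gainPU h k) m * withVirtual (x.p k) m)

/-- The weighted instantaneous sum-rate `∑ k, ∑ m, β^m w_{k,2}^m r_{k,2}^m(h_{k,2}^m p_{k,2}^m)`. -/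
def weightedRate (h : CSI K M) (x : Allocation K M) : ℝ :=
  ∑ k, ∑ m, withVirtual S.β m * x.w k m * rateSU (withVirtual (gainSU h k) m * withVirtual (x.p k) m)

/-- The instantaneous (short-term) constraints: binary scheduling, exactly one (possibly virtual)
user per band, powers between zero and the peak power. -/
structure Admissible (h : CSI K M) (x : Allocation K M) : Prop where
  binary : ∀ k m, x.w k m = 0 ∨ x.w k m = 1
  one_user : ∀ k, ∑ m, x.w k m = 1
  power_mem : ∀ k m, x.p k m ∈ Set.Icc 0 (S.peak h k m)

/-- Feasible policies `h ↦ (w(h), p(h))` of the resource allocation problem when the CSI has law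
`ν`. The long-term constraints of the PUs, which are conditional on the PU being active, are written
as `E[a X] ≤ E[a] c`. -/
structure Feasible (ν : Measure (CSI K M)) (z : CSI K M → Allocation K M) : Prop where
  measurable_w : ∀ k m, Measurable fun h => (z h).w k m
  measurable_p : ∀ k m, Measurable fun h => (z h).p k m
  admissible : ∀ h, S.Admissible h (z h)
  avg_power : ∀ m, ∫ h, usedPower (z h) m ∂ν ≤ S.maxAvgPower m
  integrable_interf : ∀ k, Integrable (fun h => activity h k * interference h (z h) k) ν
  avg_interf : ∀ k, ∫ h, activity h k * interference h (z h) k ∂ν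
    ≤ (∫ h, activity h k ∂ν) * S.maxInterf k
  avg_rate : ∀ k, (∫ h, activity h k ∂ν) * S.minRate k
    ≤ ∫ h, activity h k * S.primaryRate h (z h) k ∂ν

/-- The optimal value of the resource allocation problem: the supremum over all feasible policies
of the weighted ergodic sum-capacity. -/
def optimalValue (ν : Measure (CSI K M)) : ℝ :=
  sSup {c | ∃ z, S.Feasible ν z ∧ c = ∫ h, S.weightedRate h (z h) ∂ν}

/-- The user-channel quality indicator `φ_k^m(q)`; for the virtual user it is used with `q = 0`. -/
def quality (h : CSI K M) (lam : Multipliers K M) (k : Fin K) (m : Option (Fin M)) (q : ℝ) : ℝ :=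
  withVirtual S.β m * rateSU (withVirtual (gainSU h k) m * q)
    - withVirtual lam.pi m * q
    - lam.theta k * activity h k * withVirtual (gainPU h k) m * q
    + lam.rho k * activity h k * S.ratePU k (withVirtual (gainPU h k) m * q)

/-- `x` is the resource allocation computed from the CSI `h` and the multipliers `lam`: every power
maximizes the quality indicator over the interval between zero and the peak power, and in every band
a user with the largest quality indicator is scheduled; it must have positive power unless it is the
virtual user. Remaining ties are broken arbitrarily. -/
structure IsDualAllocation (h : CSI K M) (lam : Multipliers K M) (x : Allocation K M) : Prop where
  admissible : S.Admissible h x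
  power_max : ∀ k m, ∀ q ∈ Set.Icc 0 (S.peak h k m),
    S.quality h lam k (some m) q ≤ S.quality h lam k (some m) (x.p k m)
  winner_max : ∀ k m, x.w k m = 1 → ∀ l,
    S.quality h lam k l (withVirtual (x.p k) l) ≤ S.quality h lam k m (withVirtual (x.p k) m)
  winner_active : ∀ k m, x.w k m = 1 → 0 < withVirtual (x.p k) m ∨ m = none

/-- Update term of `π^m`. -/
def updatePi (x : Allocation K M) (m : Fin M) : ℝ := S.maxAvgPower m - usedPower x m

/-- Update term of `θ_k`. -/
def updateTheta (h : CSI K M) (x : Allocation K M) (k : Fin K) : ℝ :=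
  activity h k * (S.maxInterf k - interference h x k)

/-- Update term of `ρ_k`. -/
def updateRho (h : CSI K M) (x : Allocation K M) (k : Fin K) : ℝ :=
  activity h k * (S.minRate k - S.primaryRate h x k)

/-- Along the CSI sequence `h`, the multipliers `lam` and the allocations `x` are generated by the
projected stochastic dual subgradient iterations with constant stepsizes, from any nonnegative
initial multipliers. -/
structure IsStochasticRA (ηπ ηθ ηρ : ℝ) (h : ℕ → CSI K M) (lam : ℕ → Multipliers K M)
    (x : ℕ → Allocation K M) : Prop where
  pi_init : ∀ m, 0 ≤ (lam 0).pi m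
  theta_init : ∀ k, 0 ≤ (lam 0).theta k
  rho_init : ∀ k, 0 ≤ (lam 0).rho k
  allocation : ∀ n, S.IsDualAllocation (h n) (lam n) (x n)
  pi_step : ∀ n m,
    (lam (n + 1)).pi m = max ((lam n).pi m - ηπ * S.updatePi (x n) m) 0
  theta_step : ∀ n k,
    (lam (n + 1)).theta k = max ((lam n).theta k - ηθ * S.updateTheta (h n) (x n) k) 0
  rho_step : ∀ n k,
    (lam (n + 1)).rho k = max ((lam n).rho k + ηρ * S.updateRho (h n) (x n) k) 0

/-- All update terms along the run are bounded by `G`. -/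
structure BoundedUpdates (G : ℝ) (h : ℕ → CSI K M) (x : ℕ → Allocation K M) : Prop where
  pi_bdd : ∀ n m, |S.updatePi (x n) m| ≤ G
  theta_bdd : ∀ n k, |S.updateTheta (h n) (x n) k| ≤ G
  rho_bdd : ∀ n k, |S.updateRho (h n) (x n) k| ≤ G

end Network

/-- The sample average of the first `n` terms. -/
def sampleAverage (u : ℕ → ℝ) (n : ℕ) : ℝ := (∑ l ∈ Finset.range n, u l) / n

/-- The process `h` is stationary and ergodic: its law on the space of trajectories is invariant
and ergodic under the time shift. -/
def IsStationaryErgodic {Ω α : Type*} [MeasurableSpace Ω] [MeasurableSpace α] (μ : Measure Ω)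
    (h : ℕ → Ω → α) : Prop :=
  Ergodic (fun (s : ℕ → α) n => s (n + 1)) (μ.map fun ω n => h n ω)

end CognitiveRadio

end

/-! The dual allocation maximizes the instantaneous Lagrangian `weightedRate + price`
(`IsDualAllocation.lagrangian_le`), and the quadratic `energy` of the multipliers drops in each step
by the price paid, up to O(η G²). Summing gives `IsStochasticRA.energy_add_sum_le`: the run earns at
least rate plus price of any admissible competitor, minus the initial energy and O(η G²) per step.

With the idle competitor, whose price is nonnegative on almost every path because the problem is
feasible, the energy is O(n). The multipliers are then o(n), and telescoping their recursions yields
the long-term constraints for all stepsizes.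

With a nearly optimal feasible policy as competitor, its price must be almost nonnegative on
average. The multipliers depend on the past of a process that is merely ergodic, so conditioning is
no help. Instead, the mean ergodic theorem writes each slack as its mean (at least 0), an error
small in L¹ and a coboundary W - W∘T. Summation by parts moves the coboundary onto the increments of
the multiplier, which are O(η) (`eventually_le_sampleAverage_mul`).

The L¹ error demands multipliers bounded uniformly in the stepsize, without a Slater condition.
Halving a power costs at most one bit, so optimality of the power bounds multiplier times
consumption (`IsDualAllocation.half_power`). With a positive budget on a constraint active with
positive probability, a large multiplier therefore cannot grow (`eventually_multiplier_le`);
otherwise the slack of a feasible policy vanishes almost surely and the multiplier is irrelevant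
(`budget_pos_or_ae_eq_zero`). -/

/-! ### Pointwise and mean ergodic theorems, and approximation by coboundaries. -/

section ErgodicTheorem

variable {α : Type*} {T : α → α} {g : α → ℝ}

/-- Running maxima of the Birkhoff sums `S₁, …, Sₙ₊₁`. -/
def birkhoffMax (T : α → α) (g : α → ℝ) : ℕ → α → ℝ
  | 0, x => g x
  | n + 1, x => g x + max 0 (birkhoffMax T g n (T x))

theorem birkhoffMax_succ (n : ℕ) (x : α) :
    birkhoffMax T g (n + 1) x = g x + max 0 (birkhoffMax T g n (T x)) := rfl

theorem birkhoffMax_le_succ (n : ℕ) : ∀ x, birkhoffMax T g n x ≤ birkhoffMax T g (n + 1) x := by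
  induction n with
  | zero => intro x; rw [birkhoffMax_succ]; simp [birkhoffMax]
  | succ n ih =>
    intro x
    rw [birkhoffMax_succ, birkhoffMax_succ (n + 1)]
    gcongr
    exact ih _

theorem monotone_birkhoffMax (x : α) : Monotone fun n => birkhoffMax T g n x :=
  monotone_nat_of_le_succ fun n => birkhoffMax_le_succ n x

theorem birkhoffSum_succ_le_birkhoffMax (n : ℕ) :
    ∀ x, birkhoffSum T g (n + 1) x ≤ birkhoffMax T g n x := by
  induction n with
  | zero => intro x; simp [birkhoffMax]
  | succ n ih =>
    intro x
    rw [birkhoffSum_succ', birkhoffMax_succ]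
    gcongr
    exact (ih _).trans (le_max_right _ _)

variable [MeasurableSpace α] {μ : Measure α}

theorem measurable_birkhoffMax (hT : Measurable T) (hg : Measurable g) (n : ℕ) :
    Measurable (birkhoffMax T g n) := by
  induction n with
  | zero => exact hg
  | succ n ih => exact hg.add (measurable_const.max (ih.comp hT))

theorem integrable_birkhoffMax (hT : MeasurePreserving T μ μ) (hg : Integrable g μ) (n : ℕ) :
    Integrable (birkhoffMax T g n) μ := by
  induction n with
  | zero => exact hg
  | succ n ih =>
    have h : Integrable (fun x => birkhoffMax T g n (T x)) μ :=
      hT.integrable_comp_of_integrable ih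
    exact hg.add (((integrable_zero α ℝ μ).sup h))

/-- Birkhoff sums of a function of negative mean are almost surely bounded above. -/
theorem Ergodic.ae_exists_birkhoffSum_le [IsProbabilityMeasure μ] (hT : Ergodic T μ)
    (hgm : Measurable g) (hg : Integrable g μ) (hneg : ∫ x, g x ∂μ < 0) :
    ∀ᵐ x ∂μ, ∃ C : ℝ, ∀ n, birkhoffSum T g n x ≤ C := by
  -- `A` is invariant. On it `birkhoffMax` at `T x` is eventually positive, so the increments in
  -- `hlim` become `g`, while their integrals over `A` are nonnegative by invariance and
  -- monotonicity. A set `A` of full measure would thus contradict the negative mean.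
  set A : Set α := {x | ∀ C : ℕ, ∃ n, (C : ℝ) < birkhoffMax T g n x} with hA
  have hAm : MeasurableSet A := by
    have : A = ⋂ C : ℕ, ⋃ n, {x | (C : ℝ) < birkhoffMax T g n x} := by
      ext x; simp [hA]
    rw [this]
    exact MeasurableSet.iInter fun C => MeasurableSet.iUnion fun n =>
      measurableSet_lt measurable_const (measurable_birkhoffMax hT.measurable hgm n)
  have hinv : T ⁻¹' A = A := by
    ext x
    simp only [hA, Set.mem_preimage, Set.mem_ofPred_eq]
    constructor
    · intro h C
      obtain ⟨D, hD⟩ := exists_nat_gt ((C : ℝ) - g x)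
      obtain ⟨n, hn⟩ := h D
      refine ⟨n + 1, ?_⟩
      rw [birkhoffMax_succ]
      linarith [le_max_right 0 (birkhoffMax T g n (T x))]
    · intro h C
      -- The margin `|g x|` ensures that the maximum with 0 is not attained at 0.
      obtain ⟨D, hD⟩ := exists_nat_gt ((C : ℝ) + |g x|)
      obtain ⟨n, hn⟩ := h D
      refine ⟨n, ?_⟩
      have h1 := hn.trans_le (birkhoffMax_le_succ n x)
      rw [birkhoffMax_succ] at h1
      have h2 : (C : ℝ) < max 0 (birkhoffMax T g n (T x)) := by
        linarith [le_abs_self (g x)]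
      rcases lt_max_iff.1 h2 with h3 | h3
      · exact absurd h3 (not_lt.2 (Nat.cast_nonneg C))
      · exact h3
  have hTmp := hT.toMeasurePreserving
  have hlim : Tendsto (fun n => ∫ x in A, (birkhoffMax T g (n + 1) x - birkhoffMax T g n (T x)) ∂μ)
      atTop (𝓝 (∫ x in A, g x ∂μ)) := by
    refine tendsto_integral_of_dominated_convergence (fun x => |g x| + |g (T x)|) ?_ ?_ ?_ ?_
    · intro n
      exact ((measurable_birkhoffMax hT.measurable hgm (n + 1)).sub
        ((measurable_birkhoffMax hT.measurable hgm n).comp hT.measurable)).aestronglyMeasurable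
    · exact (hg.abs.add (hTmp.integrable_comp_of_integrable hg).abs).integrableOn
    · intro n
      refine Eventually.of_forall fun x => ?_
      have h0 : g (T x) ≤ birkhoffMax T g n (T x) :=
        monotone_birkhoffMax (T := T) (g := g) (T x) (Nat.zero_le n)
      rw [birkhoffMax_succ, Real.norm_eq_abs]
      rcases le_total 0 (birkhoffMax T g n (T x)) with h | h
      · rw [max_eq_right h]
        simp
      · rw [max_eq_left h]
        refine (abs_sub _ _).trans ?_
        rw [add_zero]
        gcongr 1
        rw [abs_of_nonpos h, abs_of_nonpos (h0.trans h)]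
        linarith
    · rw [ae_restrict_iff' hAm]
      refine Eventually.of_forall fun x hx => ?_
      have hx' : T x ∈ A := by rwa [← hinv] at hx
      obtain ⟨n, hn⟩ := hx' 0
      refine tendsto_const_nhds.congr' ?_
      filter_upwards [eventually_ge_atTop n] with k hk
      have : 0 < birkhoffMax T g k (T x) := by
        simpa using hn.trans_le (monotone_birkhoffMax (T := T) (g := g) (T x) hk)
      rw [birkhoffMax_succ, max_eq_right this.le]
      ring
  have hnonneg : 0 ≤ ∫ x in A, g x ∂μ := by
    refine ge_of_tendsto' hlim fun n => ?_
    have hi := integrable_birkhoffMax hTmp hg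
    have h0 : Integrable (fun x => birkhoffMax T g n (T x)) μ :=
      hTmp.integrable_comp_of_integrable (hi n)
    rw [integral_sub (hi (n + 1)).integrableOn h0.integrableOn]
    have h1 : ∫ x in A, birkhoffMax T g n (T x) ∂μ = ∫ x in A, birkhoffMax T g n x ∂μ := by
      have h2 := hTmp.restrict_preimage hAm
      rw [hinv] at h2
      have h3 := integral_map (μ := μ.restrict A) (φ := T) hT.measurable.aemeasurable
        (f := birkhoffMax T g n)
        (measurable_birkhoffMax hT.measurable hgm n).aestronglyMeasurable
      rw [h2.map_eq] at h3
      exact h3.symm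
    rw [h1, sub_nonneg]
    exact integral_mono (hi n).integrableOn (hi (n + 1)).integrableOn (birkhoffMax_le_succ n)
  rcases hT.toPreErgodic.ae_mem_or_ae_notMem hAm hinv with h | h
  · rw [Measure.restrict_eq_self_of_ae_mem h] at hnonneg
    linarith
  · filter_upwards [h] with x hx
    simp only [hA, Set.mem_ofPred_eq, not_forall, not_exists, not_lt] at hx
    obtain ⟨C, hC⟩ := hx
    refine ⟨C, fun n => ?_⟩
    cases n with
    | zero => simp
    | succ n => exact (birkhoffSum_succ_le_birkhoffMax n x).trans (hC n)

/-- For `b` strictly between the mean and `c`, the sums of `g - b` are bounded by some `C`, and `C /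
n + b` is eventually below `c`. -/
theorem Ergodic.ae_eventually_birkhoffSum_div_lt [IsProbabilityMeasure μ] (hT : Ergodic T μ)
    (hgm : Measurable g) (hg : Integrable g μ) {c : ℝ} (hc : ∫ x, g x ∂μ < c) :
    ∀ᵐ x ∂μ, ∀ᶠ n : ℕ in atTop, birkhoffSum T g n x / n < c := by
  obtain ⟨b, hb, hbc⟩ := exists_between hc
  have h := hT.ae_exists_birkhoffSum_le (g := fun x => g x - b) (hgm.sub_const b)
    (hg.sub (integrable_const b)) (by
      rw [integral_sub hg (integrable_const b)]
      simpa using hb)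
  filter_upwards [h] with x ⟨C, hC⟩
  have hlim : Tendsto (fun n : ℕ => C / n + b) atTop (𝓝 (0 + b)) :=
    (tendsto_const_div_atTop_nhds_zero_nat C).add_const b
  rw [zero_add] at hlim
  filter_upwards [hlim.eventually_lt_const hbc, eventually_gt_atTop 0] with n hn hn0
  refine lt_of_le_of_lt ?_ hn
  have hn0' : (0 : ℝ) < n := by exact_mod_cast hn0
  have := hC n
  have h2 : birkhoffSum T (fun x => g x - b) n x = birkhoffSum T g n x - n * b := by
    simp [birkhoffSum]
  rw [h2] at this
  rw [div_add' _ _ _ hn0'.ne']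
  gcongr
  linarith

/-- Birkhoff's pointwise ergodic theorem. -/
theorem Ergodic.ae_tendsto_birkhoffSum_div [IsProbabilityMeasure μ] (hT : Ergodic T μ)
    (hgm : Measurable g) (hg : Integrable g μ) :
    ∀ᵐ x ∂μ, Tendsto (fun n : ℕ => birkhoffSum T g n x / n) atTop (𝓝 (∫ x, g x ∂μ)) := by
  have h1 : ∀ j : ℕ, ∀ᵐ x ∂μ, ∀ᶠ n : ℕ in atTop,
      birkhoffSum T g n x / n < (∫ x, g x ∂μ) + 1 / ((j : ℝ) + 1) := fun j =>
    hT.ae_eventually_birkhoffSum_div_lt hgm hg (by linarith [Nat.one_div_pos_of_nat (α := ℝ) (n := j)])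
  have h2 : ∀ j : ℕ, ∀ᵐ x ∂μ, ∀ᶠ n : ℕ in atTop,
      birkhoffSum T (-g) n x / n < -(∫ x, g x ∂μ) + 1 / ((j : ℝ) + 1) := fun j =>
    hT.ae_eventually_birkhoffSum_div_lt hgm.neg hg.neg (by
      rw [← integral_neg]
      exact lt_add_of_pos_right _ (Nat.one_div_pos_of_nat (α := ℝ) (n := j)))
  rw [← ae_all_iff] at h1 h2
  filter_upwards [h1, h2] with x hx1 hx2
  rw [Metric.tendsto_nhds]
  intro ε hε
  obtain ⟨j, hj⟩ := exists_nat_one_div_lt hε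
  filter_upwards [hx1 j, hx2 j] with n hn1 hn2
  rw [birkhoffSum_neg, neg_div] at hn2
  rw [Real.dist_eq, abs_sub_lt_iff]
  constructor <;> linarith

/-- The `L¹` mean ergodic theorem. -/
theorem Ergodic.tendsto_integral_abs_birkhoffSum_div_sub [IsProbabilityMeasure μ]
    (hT : Ergodic T μ) (hgm : Measurable g) (hg : Integrable g μ) :
    Tendsto (fun n : ℕ => ∫ x, |birkhoffSum T g n x / n - ∫ y, g y ∂μ| ∂μ) atTop (𝓝 0) := by
  have hTn := fun n => hT.toMeasurePreserving.iterate n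
  have havg : ∀ n : ℕ, AEStronglyMeasurable (fun x => birkhoffSum T g n x / n) μ := fun n =>
    ((Finset.measurable_sum _ fun k _ => hgm.comp (hTn k).measurable).div_const
      (n : ℝ)).aestronglyMeasurable
  -- The functions `g ∘ T^[n]` are identically distributed, hence uniformly integrable; averaging
  -- preserves this, and Vitali's theorem upgrades pointwise to L¹ convergence.
  have hui : UnifIntegrable (fun (n : ℕ) x => birkhoffSum T g n x / n) 1 μ := by
    have h1 : UniformIntegrable (fun n : ℕ => g ∘ T^[n]) 1 μ := by
      refine ProbabilityTheory.MemLp.uniformIntegrable_of_identDistrib (j := 0) le_rfl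
        ENNReal.one_ne_top (by simpa using memLp_one_iff_integrable.2 hg) fun i => ?_
      refine ⟨(hgm.comp (hTn i).measurable).aemeasurable, by simpa using hgm.aemeasurable, ?_⟩
      rw [← Measure.map_map hgm (hTn i).measurable, (hTn i).map_eq]
      simp
    have h2 := (uniformIntegrable_average le_rfl h1).unifIntegrable
    convert h2 using 3 with n x
    simp [birkhoffSum, div_eq_inv_mul]
  have h := tendsto_Lp_finite_of_tendsto_ae le_rfl ENNReal.one_ne_top havg
    (memLp_const (∫ y, g y ∂μ)) hui (hT.ae_tendsto_birkhoffSum_div hgm hg)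
  have h' := (ENNReal.tendsto_toReal ENNReal.zero_ne_top).comp h
  refine Tendsto.congr (fun n => ?_) h'
  have hi : AEStronglyMeasurable ((fun x => birkhoffSum T g n x / n) - fun _ => ∫ y, g y ∂μ) μ :=
    (havg n).sub aestronglyMeasurable_const
  simp only [Function.comp_apply]
  rw [eLpNorm_one_eq_lintegral_enorm, ← integral_norm_eq_lintegral_enorm hi]
  simp [Real.norm_eq_abs]

/-- An integrable function is, up to a constant and an error of small mean absolute value, a
coboundary. -/
theorem Ergodic.exists_coboundary_approx [IsProbabilityMeasure μ] (hT : Ergodic T μ)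
    (hgm : Measurable g) (hg : Integrable g μ) {ε : ℝ} (hε : 0 < ε) :
    ∃ r W : α → ℝ, Measurable r ∧ Integrable r μ ∧ Measurable W ∧ Integrable W μ ∧
      ∫ x, |r x| ∂μ < ε ∧ ∀ x, g x = (∫ y, g y ∂μ) + r x + (W x - W (T x)) := by
  obtain ⟨n, hn, hn0⟩ := (((hT.tendsto_integral_abs_birkhoffSum_div_sub hgm hg).eventually_lt_const
    hε).and (eventually_gt_atTop 0)).exists
  have hTn := fun n => hT.toMeasurePreserving.iterate n
  have hSm : ∀ j, Measurable (birkhoffSum T g j) := fun j =>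
    Finset.measurable_sum _ fun k _ => hgm.comp (hTn k).measurable
  have hSi : ∀ j, Integrable (birkhoffSum T g j) μ := fun j =>
    integrable_finsetSum _ fun k _ => (hTn k).integrable_comp_of_integrable hg
  -- With W the mean of the Birkhoff sums S₀, …, Sₙ₋₁, the identity Sⱼ∘T = Sⱼ + g∘Tʲ - g gives W -
  -- W∘T = g - Sₙ/n.
  refine ⟨fun x => birkhoffSum T g n x / n - ∫ y, g y ∂μ,
    fun x => (∑ j ∈ Finset.range n, birkhoffSum T g j x) / n,
    ((hSm n).div_const _).sub_const _, ((hSi n).div_const _).sub (integrable_const _),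
    (Finset.measurable_sum _ fun j _ => hSm j).div_const _,
    (integrable_finsetSum _ fun j _ => hSi j).div_const _, hn, fun x => ?_⟩
  have hn0' : (n : ℝ) ≠ 0 := by exact_mod_cast hn0.ne'
  have h1 : ∑ j ∈ Finset.range n, birkhoffSum T g j (T x)
      = (∑ j ∈ Finset.range n, birkhoffSum T g j x) + (birkhoffSum T g n x - n * g x) := by
    have h2 : ∀ j, birkhoffSum T g j (T x) = birkhoffSum T g j x + (g (T^[j] x) - g x) := fun j => by
      rw [← birkhoffSum_apply_sub_birkhoffSum]; ring
    simp only [h2, Finset.sum_add_distrib, Finset.sum_sub_distrib]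
    simp [birkhoffSum]
  dsimp only
  rw [h1]
  field_simp
  ring

end ErgodicTheorem

namespace CognitiveRadio

/-! ### Transfer to stationary ergodic processes. -/

section StationaryProcess

variable {Ω α : Type*} [MeasurableSpace Ω] [MeasurableSpace α] {μ : Measure Ω} {h : ℕ → Ω → α}

theorem iterate_shift_apply {α : Type*} (s : ℕ → α) (l n : ℕ) :
    (fun (s : ℕ → α) n => s (n + 1))^[l] s n = s (n + l) := by
  induction l generalizing s n with
  | zero => rfl
  | succ l ih => rw [Function.iterate_succ_apply, ih]; congr 1

theorem IsStationaryErgodic.map_eq (hmeas : ∀ n, Measurable (h n)) (hstat : IsStationaryErgodic μ h)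
    (n : ℕ) : μ.map (h n) = μ.map (h 0) := by
  have hm : Measurable fun ω n => h n ω := measurable_pi_lambda _ hmeas
  have h1 := (hstat.toMeasurePreserving.iterate n)
  have h0 : ∀ l, μ.map (h l) = (μ.map fun ω n => h n ω).map fun s => s l := fun l => by
    rw [Measure.map_map (measurable_pi_apply l) hm]; rfl
  rw [h0 n, h0 0]
  conv_rhs => rw [← h1.map_eq, Measure.map_map (measurable_pi_apply 0) h1.measurable]
  congr 1
  ext s
  simp [iterate_shift_apply]

theorem IsStationaryErgodic.ae_forall (hmeas : ∀ n, Measurable (h n))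
    (hstat : IsStationaryErgodic μ h) {P : α → Prop} (hP : ∀ᵐ c ∂(μ.map (h 0)), P c) :
    ∀ᵐ ω ∂μ, ∀ n, P (h n ω) := by
  rw [ae_all_iff]
  intro n
  rw [← hstat.map_eq hmeas n] at hP
  exact ae_of_ae_map (hmeas n).aemeasurable hP

/-- Functions of the whole trajectory are needed because the error and the coboundary of a function
of one state involve future states. -/
theorem IsStationaryErgodic.ae_tendsto_sampleAverage_path [IsProbabilityMeasure μ] (hmeas : ∀ n, Measurable (h n))
    (hstat : IsStationaryErgodic μ h) {g : (ℕ → α) → ℝ} (hgm : Measurable g)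
    (hg : Integrable g (μ.map fun ω n => h n ω)) :
    ∀ᵐ ω ∂μ, Tendsto (sampleAverage fun l => g fun n => h (n + l) ω) atTop
      (𝓝 (∫ s, g s ∂(μ.map fun ω n => h n ω))) := by
  have hm : Measurable fun ω n => h n ω := measurable_pi_lambda _ hmeas
  have := Measure.isProbabilityMeasure_map (μ := μ) hm.aemeasurable
  have h1 := ae_of_ae_map hm.aemeasurable (hstat.ae_tendsto_birkhoffSum_div hgm hg)
  filter_upwards [h1] with ω hω
  refine hω.congr fun n => ?_
  simp only [birkhoffSum, sampleAverage]
  congr 1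
  refine Finset.sum_congr rfl fun l _ => congrArg g ?_
  ext n
  rw [iterate_shift_apply]

theorem integrable_path {u : α → ℝ} (hmeas : ∀ n, Measurable (h n)) (hum : Measurable u)
    (hu : Integrable u (μ.map (h 0))) :
    Integrable (fun s : ℕ → α => u (s 0)) (μ.map fun ω n => h n ω) := by
  have hm : Measurable fun ω n => h n ω := measurable_pi_lambda _ hmeas
  have hu0 : Measurable fun s : ℕ → α => u (s 0) := hum.comp (measurable_pi_apply 0)
  rw [integrable_map_measure hu0.aestronglyMeasurable hm.aemeasurable]
  exact (integrable_map_measure hum.aestronglyMeasurable (hmeas 0).aemeasurable).1 hu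

theorem integral_path {u : α → ℝ} (hmeas : ∀ n, Measurable (h n)) (hum : Measurable u) :
    ∫ s, u (s 0) ∂(μ.map fun ω n => h n ω) = ∫ c, u c ∂(μ.map (h 0)) := by
  have hm : Measurable fun ω n => h n ω := measurable_pi_lambda _ hmeas
  have hu0 : Measurable fun s : ℕ → α => u (s 0) := hum.comp (measurable_pi_apply 0)
  rw [integral_map hm.aemeasurable hu0.aestronglyMeasurable,
    integral_map (hmeas 0).aemeasurable hum.aestronglyMeasurable]

/-- The strong law of large numbers for functions of a stationary ergodic process. -/
theorem IsStationaryErgodic.ae_tendsto_sampleAverage [IsProbabilityMeasure μ]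
    (hmeas : ∀ n, Measurable (h n))
    (hstat : IsStationaryErgodic μ h) {u : α → ℝ} (hum : Measurable u)
    (hu : Integrable u (μ.map (h 0))) :
    ∀ᵐ ω ∂μ, Tendsto (sampleAverage fun l => u (h l ω)) atTop (𝓝 (∫ c, u c ∂(μ.map (h 0)))) := by
  have h1 := hstat.ae_tendsto_sampleAverage_path hmeas (hum.comp (measurable_pi_apply 0))
    (integrable_path hmeas hum hu)
  simp only [Function.comp_def, zero_add, integral_path hmeas hum] at h1
  exact h1

/-- `R` and `A` are expectations, chosen before `ω`, so a stepsize threshold built from them serves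
almost every path. -/
theorem IsStationaryErgodic.exists_coboundary_approx [IsProbabilityMeasure μ]
    (hmeas : ∀ n, Measurable (h n))
    (hstat : IsStationaryErgodic μ h) {u : α → ℝ} (hum : Measurable u)
    (hu : Integrable u (μ.map (h 0))) {ε : ℝ} (hε : 0 < ε) :
    ∃ R A : ℝ, R < ε ∧ ∀ᵐ ω ∂μ, ∃ r W : ℕ → ℝ,
      (∀ l, u (h l ω) = (∫ c, u c ∂(μ.map (h 0))) + r l + (W l - W (l + 1))) ∧
      Tendsto (sampleAverage fun l => |r l|) atTop (𝓝 R) ∧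
      Tendsto (sampleAverage fun l => |W l|) atTop (𝓝 A) := by
  have hm : Measurable fun ω n => h n ω := measurable_pi_lambda _ hmeas
  have := Measure.isProbabilityMeasure_map (μ := μ) hm.aemeasurable
  obtain ⟨r, W, hrm, hr, hWm, hW, hrε, heq⟩ := Ergodic.exists_coboundary_approx hstat
    (hum.comp (measurable_pi_apply 0)) (integrable_path hmeas hum hu) hε
  refine ⟨_, ∫ s, |W s| ∂(μ.map fun ω n => h n ω), hrε, ?_⟩
  filter_upwards [hstat.ae_tendsto_sampleAverage_path hmeas hrm.abs hr.abs,
    hstat.ae_tendsto_sampleAverage_path hmeas hWm.abs hW.abs] with ω h1 h2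
  refine ⟨fun l => r fun n => h (n + l) ω, fun l => W fun n => h (n + l) ω, fun l => ?_, h1, h2⟩
  have h3 := heq fun n => h (n + l) ω
  simp only [Function.comp_apply, zero_add, integral_path hmeas hum] at h3
  rw [h3]
  simp only [add_assoc, add_comm 1 l]

end StationaryProcess

/-! ### Sample averages and summation by parts. -/

section SampleAverage

theorem sampleAverage_add (u v : ℕ → ℝ) (n : ℕ) :
    sampleAverage (fun l => u l + v l) n = sampleAverage u n + sampleAverage v n := by
  simp [sampleAverage, Finset.sum_add_distrib, add_div]

theorem sampleAverage_sub (u v : ℕ → ℝ) (n : ℕ) :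
    sampleAverage (fun l => u l - v l) n = sampleAverage u n - sampleAverage v n := by
  simp [sampleAverage, Finset.sum_sub_distrib, sub_div]

theorem sampleAverage_const_mul (c : ℝ) (u : ℕ → ℝ) (n : ℕ) :
    sampleAverage (fun l => c * u l) n = c * sampleAverage u n := by
  rw [sampleAverage, ← Finset.mul_sum, mul_div_assoc, sampleAverage]

theorem sampleAverage_sum {ι : Type*} (s : Finset ι) (u : ι → ℕ → ℝ) (n : ℕ) :
    sampleAverage (fun l => ∑ i ∈ s, u i l) n = ∑ i ∈ s, sampleAverage (u i) n := by
  simp only [sampleAverage]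
  rw [Finset.sum_comm, Finset.sum_div]

theorem tendsto_sampleAverage_of_eventually_eq_zero {u : ℕ → ℝ} (hu : ∀ᶠ l in atTop, u l = 0) :
    Tendsto (sampleAverage u) atTop (𝓝 0) := by
  have h1 : Tendsto u atTop (𝓝 0) := tendsto_const_nhds.congr' (hu.mono fun _ h => h.symm)
  refine h1.cesaro.congr fun n => ?_
  rw [sampleAverage, div_eq_inv_mul]

/-- The term `u n` is a difference of consecutive partial sums. This disposes of the boundary terms
of the summation by parts. -/
theorem tendsto_div_of_tendsto_sampleAverage {u : ℕ → ℝ} {A : ℝ}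
    (hu : Tendsto (sampleAverage u) atTop (𝓝 A)) :
    Tendsto (fun n : ℕ => u n / n) atTop (𝓝 0) := by
  have h1 : Tendsto (fun n : ℕ => sampleAverage u (n + 1) * (1 + 1 / (n : ℝ)) - sampleAverage u n)
      atTop (𝓝 (A * (1 + 0) - A)) :=
    (((tendsto_add_atTop_iff_nat 1).2 hu).mul
      (tendsto_one_div_atTop_nhds_zero_nat.const_add 1)).sub hu
  have h2 : A * (1 + 0) - A = 0 := by ring
  rw [h2] at h1
  refine h1.congr' ?_
  filter_upwards [eventually_gt_atTop 0] with n hn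
  have hn' : (n : ℝ) ≠ 0 := by exact_mod_cast hn.ne'
  have hn'' : (n : ℝ) + 1 ≠ 0 := by positivity
  simp only [sampleAverage, Finset.sum_range_succ]
  push_cast
  field_simp
  ring

/-- Averages of a slowly varying nonnegative bounded sequence against a sequence that is, up to a
nonnegative constant and a small error, a coboundary. -/
theorem eventually_le_sampleAverage_mul {lam u r W : ℕ → ℝ} {c Λ κ R A : ℝ} (hc : 0 ≤ c)
    (hκ : 0 ≤ κ)
    (hlam : ∀ l, 0 ≤ lam l) (hlamΛ : ∀ᶠ l in atTop, lam l ≤ Λ)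
    (hstep : ∀ l, |lam (l + 1) - lam l| ≤ κ)
    (hu : ∀ l, u l = c + r l + (W l - W (l + 1)))
    (hr : Tendsto (sampleAverage fun l => |r l|) atTop (𝓝 R))
    (hW : Tendsto (sampleAverage fun l => |W l|) atTop (𝓝 A)) {ε : ℝ} (hε : 0 < ε) :
    ∀ᶠ n in atTop, -(Λ * R + κ * A) - ε ≤ sampleAverage (fun l => lam l * u l) n := by
  -- The bound `Λ` holds only eventually; the excess over it lives at finitely many times and
  -- averages out.
  have he : Tendsto (sampleAverage fun l => max (lam l - Λ) 0 * |r l|) atTop (𝓝 0) := by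
    refine tendsto_sampleAverage_of_eventually_eq_zero ?_
    filter_upwards [hlamΛ] with l hl
    rw [max_eq_right (by linarith), zero_mul]
  have hWn := tendsto_div_of_tendsto_sampleAverage hW
  have h0 : Tendsto (fun n : ℕ => (-(|lam 0 * W 0|)) / (n : ℝ)) atTop (𝓝 0) :=
    tendsto_const_div_atTop_nhds_zero_nat _
  have hlim : Tendsto (fun n : ℕ => -(Λ * sampleAverage (fun l => |r l|) n)
      - sampleAverage (fun l => max (lam l - Λ) 0 * |r l|) n
      + (-(|lam 0 * W 0|)) / (n : ℝ) - Λ * (|W n| / n) - κ * sampleAverage (fun l => |W l|) n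
      - κ * (|W n| / n)) atTop (𝓝 (-(Λ * R) - 0 + 0 - Λ * 0 - κ * A - κ * 0)) :=
    (((((hr.const_mul Λ).neg.sub he).add h0).sub (hWn.const_mul Λ)).sub
      (hW.const_mul κ)).sub (hWn.const_mul κ)
  have hval : -(Λ * R + κ * A) - ε < -(Λ * R) - 0 + 0 - Λ * 0 - κ * A - κ * 0 := by linarith
  filter_upwards [hlim.eventually_const_lt hval, hlamΛ] with n hn hnΛ
  refine hn.le.trans ?_
  have key : -(Λ * ∑ l ∈ Finset.range n, |r l|)
      - ∑ l ∈ Finset.range n, max (lam l - Λ) 0 * |r l|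
      + (-(|lam 0 * W 0|)) - Λ * |W n| - κ * ∑ l ∈ Finset.range n, |W l|
      - κ * |W n| ≤ ∑ l ∈ Finset.range n, lam l * u l := by
    -- Summation by parts: the coboundary leaves two boundary terms and Σ (lam (l+1) - lam l) W
    -- (l+1).
    have hsum : ∀ k, -(Λ * ∑ l ∈ Finset.range k, |r l|)
        - (∑ l ∈ Finset.range k, max (lam l - Λ) 0 * |r l|)
        + lam 0 * W 0 - lam k * W k - κ * (∑ l ∈ Finset.range k, |W (l + 1)|)
        ≤ ∑ l ∈ Finset.range k, lam l * u l := by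
      intro k
      induction k with
      | zero => simp
      | succ k ih =>
        simp only [Finset.sum_range_succ, hu k]
        have h1 : -(Λ * |r k|) - max (lam k - Λ) 0 * |r k| ≤ lam k * r k := by
          have h2 : lam k * |r k| ≤ (Λ + max (lam k - Λ) 0) * |r k| := by
            gcongr
            linarith [le_max_left (lam k - Λ) 0]
          have h3 : -(lam k * |r k|) ≤ lam k * r k := by
            rw [← mul_neg]
            exact mul_le_mul_of_nonneg_left (neg_abs_le _) (hlam k)
          linarith
        have h4 : -((lam (k + 1) - lam k) * W (k + 1)) ≤ κ * |W (k + 1)| := by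
          refine (neg_le_abs _).trans ?_
          rw [abs_mul]
          gcongr
          exact hstep k
        have h5 := mul_nonneg (hlam k) hc
        linarith
    have h6 : ∑ l ∈ Finset.range n, |W (l + 1)| ≤ (∑ l ∈ Finset.range n, |W l|) + |W n| := by
      have h7 := Finset.sum_range_succ' (fun l => |W l|) n
      rw [Finset.sum_range_succ] at h7
      linarith [abs_nonneg (W 0)]
    have h8 := mul_le_mul_of_nonneg_left h6 hκ
    have h9 : lam n * W n ≤ Λ * |W n| :=
      (mul_le_mul_of_nonneg_left (le_abs_self _) (hlam n)).trans
        (mul_le_mul_of_nonneg_right hnΛ (abs_nonneg _))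
    linarith [hsum n, neg_abs_le (lam 0 * W 0)]
  have h10 := div_le_div_of_nonneg_right key (Nat.cast_nonneg (α := ℝ) n)
  refine le_trans (le_of_eq ?_) h10
  simp only [sampleAverage]
  ring

end SampleAverage

/-! ### A single projected multiplier. -/

section Multiplier

/-- A projected subgradient step changes a nonnegative multiplier by at most the stepsize times the
update term. -/
theorem abs_projected_step_sub_le {a e g η G : ℝ} (ha : 0 ≤ a) (he : 0 < e) (heη : e ≤ η)
    (hg : |g| ≤ G) : |max (a - e * g) 0 - a| ≤ η * G := by
  have h1 := abs_max_sub_max_le_abs (a - e * g) a 0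
  rw [max_eq_left ha] at h1
  refine h1.trans ?_
  rw [sub_sub_cancel_left, abs_neg, abs_mul, abs_of_pos he]
  exact mul_le_mul heη hg (abs_nonneg _) (he.le.trans heη)

/-- Projection onto the half-line does not increase the square. Dividing by `2 * e` frees the linear
term from the stepsize, so multipliers with different stepsizes can be summed to a price. -/
theorem projected_step_sq_le {a e g η G : ℝ} (he : 0 < e) (heη : e ≤ η) (hg : |g| ≤ G) :
    (max (a - e * g) 0) ^ 2 / (2 * e) ≤ a ^ 2 / (2 * e) - a * g + η * G ^ 2 / 2 := by
  have h1 : (max (a - e * g) 0) ^ 2 ≤ (a - e * g) ^ 2 := by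
    rcases le_total (a - e * g) 0 with h | h
    · rw [max_eq_right h, zero_pow two_ne_zero]; positivity
    · rw [max_eq_left h]
  have h2 : g ^ 2 ≤ G ^ 2 := by
    rw [← sq_abs g]; exact pow_le_pow_left₀ (abs_nonneg _) hg 2
  have h3 : e * g ^ 2 ≤ η * G ^ 2 := mul_le_mul heη h2 (sq_nonneg _) (he.le.trans heη)
  calc (max (a - e * g) 0) ^ 2 / (2 * e) ≤ (a - e * g) ^ 2 / (2 * e) := by gcongr
    _ = a ^ 2 / (2 * e) - a * g + e * g ^ 2 / 2 := by field_simp; ring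
    _ ≤ _ := by linarith

/-- A multiplier whose product with the consumed resource is bounded is itself eventually bounded,
provided that the budget is positive. -/
theorem eventually_multiplier_le {lam c ind g : ℕ → ℝ} {b C e η G : ℝ} (hb : 0 < b) (hC : 0 ≤ C)
    (he : 0 < e) (heη : e ≤ η) (hlam : ∀ n, 0 ≤ lam n) (hind : ∀ n, 0 ≤ ind n)
    (hcC : ∀ n, lam n * c n ≤ C * ind n)
    (hg : ∀ n, g n = b * ind n - c n) (hgG : ∀ n, |g n| ≤ G)
    (hstep : ∀ n, lam (n + 1) = max (lam n - e * g n) 0)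
    {a : ℝ} (ha : 0 < a) (hinda : Tendsto (sampleAverage ind) atTop (𝓝 a)) :
    ∀ᶠ n in atTop, lam n ≤ 2 * C / b + η * G := by
  have hG : 0 ≤ G := (abs_nonneg _).trans (hgG 0)
  have hη : 0 < η := he.trans_le heη
  have hB : 0 ≤ 2 * C / b := by positivity
  -- Above `2 * C / b`, the bound on `lam n * c n` forces the consumption below half the budget.
  have hdec : ∀ n, 2 * C / b < lam n → b / 2 * ind n ≤ g n := by
    intro n hn
    have hpos := hB.trans_lt hn
    have h1 : lam n * c n ≤ lam n * (b / 2 * ind n) := by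
      refine (hcC n).trans ?_
      rw [div_lt_iff₀ hb] at hn
      have := mul_le_mul_of_nonneg_right hn.le (hind n)
      linarith
    have := le_of_mul_le_mul_left h1 hpos
    rw [hg n]
    linarith
  -- Below `2 * C / b` one step overshoots by at most `η * G`; above it the multiplier does not
  -- increase.
  have habsorb : ∀ n, lam n ≤ 2 * C / b + η * G → lam (n + 1) ≤ 2 * C / b + η * G := by
    intro n hn
    rcases le_or_gt (lam n) (2 * C / b) with h | h
    · have := abs_projected_step_sub_le (hlam n) he heη (hgG n)
      rw [← hstep] at this
      linarith [le_abs_self (lam (n + 1) - lam n)]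
    · have h1 := hdec n h
      have h2 : 0 ≤ e * g n := mul_nonneg he.le ((mul_nonneg (by positivity) (hind n)).trans h1)
      rw [hstep]
      exact max_le (by linarith) (by positivity)
  by_cases hex : ∃ N, lam N ≤ 2 * C / b + η * G
  · obtain ⟨N, hN⟩ := hex
    filter_upwards [eventually_ge_atTop N] with n hn
    induction n, hn using Nat.le_induction with
    | base => exact hN
    | succ k _ ih => exact habsorb k ih
  · exfalso
    push Not at hex
    have hηG : 0 ≤ η * G := by positivity
    -- A multiplier that never enters the interval decreases by a fixed multiple of `ind`, whose
    -- sums diverge, and would become negative.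
    have hsum : ∀ n, lam n ≤ lam 0 - e * (b / 2) * ∑ l ∈ Finset.range n, ind l := by
      intro n
      induction n with
      | zero => simp
      | succ n ih =>
        have h1 := hdec n (by linarith [hex n])
        have h2 : 0 < lam (n + 1) := by linarith [hex (n + 1)]
        rw [hstep] at h2
        have h3 : 0 < lam n - e * g n := by
          rcases lt_max_iff.1 h2 with h | h
          · exact h
          · exact absurd h (lt_irrefl _)
        rw [hstep, max_eq_left h3.le, Finset.sum_range_succ]
        have := mul_le_mul_of_nonneg_left h1 he.le
        linarith
    have h1 : Tendsto (fun n : ℕ => sampleAverage ind n * n) atTop atTop :=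
      hinda.pos_mul_atTop ha tendsto_natCast_atTop_atTop
    obtain ⟨n, hn, hn0⟩ := ((h1.eventually_gt_atTop (lam 0 / (e * (b / 2)))).and
      (eventually_gt_atTop 0)).exists
    have hn0' : (n : ℝ) ≠ 0 := by exact_mod_cast hn0.ne'
    rw [sampleAverage, div_mul_cancel₀ _ hn0', div_lt_iff₀ (by positivity)] at hn
    linarith [hsum n, hlam n]

/-- If a multiplier is `o(n)`, then its update terms are asymptotically nonnegative on average. -/
theorem eventually_neg_le_sampleAverage {lam g : ℕ → ℝ} {e : ℝ} (he : 0 < e)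
    (hlam : ∀ n, 0 ≤ lam n) (hstep : ∀ n, lam (n + 1) = max (lam n - e * g n) 0)
    (hlim : Tendsto (fun n : ℕ => lam n / n) atTop (𝓝 0)) {ε : ℝ} (hε : 0 < ε) :
    ∀ᶠ n in atTop, -ε ≤ sampleAverage g n := by
  have hsum : ∀ n, lam 0 - e * ∑ l ∈ Finset.range n, g l ≤ lam n := by
    intro n
    induction n with
    | zero => simp
    | succ n ih =>
      rw [Finset.sum_range_succ]
      have := le_max_left (lam n - e * g n) 0
      rw [← hstep] at this
      linarith
  filter_upwards [hlim.eventually_lt_const (mul_pos he hε), eventually_gt_atTop 0] with n hn hn0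
  have hn0' : (0 : ℝ) < n := by exact_mod_cast hn0
  rw [div_lt_iff₀ hn0'] at hn
  rw [sampleAverage, le_div_iff₀ hn0']
  have h1 := hsum n
  have h2 : e * (-ε * n) ≤ e * ∑ l ∈ Finset.range n, g l := by linarith [hlam 0]
  exact le_of_mul_le_mul_left h2 he

theorem tendsto_div_of_sq_le {lam : ℕ → ℝ} {D : ℝ} (hlam : ∀ n, 0 ≤ lam n)
    (h : ∀ᶠ n : ℕ in atTop, lam n ^ 2 ≤ D * n) :
    Tendsto (fun n : ℕ => lam n / n) atTop (𝓝 0) := by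
  have h1 : Tendsto (fun n : ℕ => Real.sqrt (D / n)) atTop (𝓝 0) := by
    have := (Real.continuous_sqrt.tendsto 0).comp (tendsto_const_div_atTop_nhds_zero_nat D)
    simpa [Function.comp_def] using this
  refine squeeze_zero' (Eventually.of_forall fun n => div_nonneg (hlam n) n.cast_nonneg) ?_ h1
  filter_upwards [h, eventually_gt_atTop 0] with n hn hn0
  have hn0' : (0 : ℝ) < n := by exact_mod_cast hn0
  refine Real.le_sqrt_of_sq_le ?_
  rw [div_pow, div_le_div_iff₀ (by positivity) hn0']
  have := mul_le_mul_of_nonneg_right hn hn0'.le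
  linarith

/-- The long-term average of a bounded slowly varying multiplier against a function of the channel
state with nonnegative mean. -/
theorem IsStationaryErgodic.exists_stepsize_neg_le_sampleAverage_mul {Ω α : Type*}
    [MeasurableSpace Ω] [MeasurableSpace α] {μ : Measure Ω} [IsProbabilityMeasure μ]
    {h : ℕ → Ω → α} (hmeas : ∀ n, Measurable (h n)) (hstat : IsStationaryErgodic μ h)
    {u : α → ℝ} (hum : Measurable u) (hu : Integrable u (μ.map (h 0)))
    (hu0 : 0 ≤ ∫ c, u c ∂(μ.map (h 0))) {B G δ : ℝ} (hB : 0 ≤ B) (hG : 0 ≤ G) (hδ : 0 < δ) :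
    ∃ η₀ > 0, ∀ᵐ ω ∂μ, ∀ η, 0 < η → η < η₀ → ∀ lam : ℕ → ℝ, (∀ l, 0 ≤ lam l) →
      (∀ᶠ l in atTop, lam l ≤ B + η * G) → (∀ l, |lam (l + 1) - lam l| ≤ η * G) →
      ∀ᶠ n in atTop, -δ ≤ sampleAverage (fun l => lam l * u (h l ω)) n := by
  -- Three errors of size `δ / 3`: the L¹ error against the bound `B + η * G ≤ B + G + 1`, the
  -- coboundary term `η * G * A`, and the slack of the limit.
  obtain ⟨R, A, hR, hae⟩ := hstat.exists_coboundary_approx hmeas hum hu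
    (ε := δ / (3 * (B + G + 1))) (by positivity)
  refine ⟨min 1 (δ / (3 * (G * |A| + 1))), by positivity, ?_⟩
  filter_upwards [hae] with ω ⟨r, W, hrW, hr, hW⟩ η hη hη₀ lam hlam hlamB hstep
  have h1 : η ≤ 1 := (hη₀.trans_le (min_le_left _ _)).le
  have h2 : η ≤ δ / (3 * (G * |A| + 1)) := (hη₀.trans_le (min_le_right _ _)).le
  filter_upwards [eventually_le_sampleAverage_mul hu0 (by positivity) hlam hlamB hstep hrW hr hW
    (ε := δ / 3) (by positivity)] with n hn
  refine le_trans ?_ hn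
  have hR0 : 0 ≤ R := ge_of_tendsto' hr fun n =>
    div_nonneg (Finset.sum_nonneg fun _ _ => abs_nonneg _) n.cast_nonneg
  have h3 : (B + η * G) * R ≤ δ / 3 := by
    have h4 : η * G ≤ G := mul_le_of_le_one_left hG h1
    have h5 : (B + η * G) * R ≤ (B + G + 1) * R :=
      mul_le_mul_of_nonneg_right (by linarith) hR0
    have h6 : (B + G + 1) * R ≤ (B + G + 1) * (δ / (3 * (B + G + 1))) := by gcongr
    have h7 : (B + G + 1) * (δ / (3 * (B + G + 1))) = δ / 3 := by
      have : B + G + 1 ≠ 0 := by positivity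
      field_simp
    linarith
  have h8 : η * G * A ≤ δ / 3 := by
    have h9 : η * G * A ≤ η * (G * |A| + 1) := by
      have := mul_le_mul_of_nonneg_left (le_abs_self A) (mul_nonneg hη.le hG)
      linarith
    have h10 : η * (G * |A| + 1) ≤ δ / (3 * (G * |A| + 1)) * (G * |A| + 1) := by gcongr
    have h11 : δ / (3 * (G * |A| + 1)) * (G * |A| + 1) = δ / 3 := by
      have : G * |A| + 1 ≠ 0 := by positivity
      field_simp
    linarith
  linarith

end Multiplier

/-! ### Elementary bounds on rates, activities and gains. -/

theorem rateSU_nonneg {x : ℝ} (hx : 0 ≤ x) : 0 ≤ rateSU x :=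
  Real.logb_nonneg one_lt_two (by linarith)

theorem rateSU_mono {x y : ℝ} (hx : 0 ≤ x) (hxy : x ≤ y) : rateSU x ≤ rateSU y :=
  Real.logb_le_logb_of_le one_lt_two (by linarith) (by linarith)

/-- Since 1 + x ≤ 2 (1 + x/2), halving costs at most one bit whatever the gain; hence the multiplier
bounds survive unbounded gains. -/
theorem rateSU_le_rateSU_half_add_one {x : ℝ} (hx : 0 ≤ x) : rateSU x ≤ rateSU (x / 2) + 1 := by
  have h1 : Real.logb 2 (2 * (1 + x / 2)) = Real.logb 2 2 + Real.logb 2 (1 + x / 2) :=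
    Real.logb_mul two_ne_zero (by positivity)
  rw [Real.logb_self_eq_one one_lt_two] at h1
  rw [rateSU, rateSU, add_comm _ (1 : ℝ), ← h1]
  exact Real.logb_le_logb_of_le one_lt_two (by linarith) (by linarith)

theorem activity_eq_zero_or_one {K M : ℕ} (h : CSI K M) (k : Fin K) :
    activity h k = 0 ∨ activity h k = 1 := by
  unfold activity; split_ifs <;> simp

theorem activity_nonneg {K M : ℕ} (h : CSI K M) (k : Fin K) : 0 ≤ activity h k := by
  rcases activity_eq_zero_or_one h k with h | h <;> simp [h]

theorem activity_le_one {K M : ℕ} (h : CSI K M) (k : Fin K) : activity h k ≤ 1 := by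
  rcases activity_eq_zero_or_one h k with h | h <;> simp [h]

theorem withVirtual_nonneg {M : ℕ} {x : Fin M → ℝ} (hx : ∀ m, 0 ≤ x m) (m : Option (Fin M)) :
    0 ≤ withVirtual x m := by
  cases m with
  | none => exact le_rfl
  | some m => exact hx m

theorem gainPU_nonneg {K M : ℕ} (h : CSI K M) (k : Fin K) (m : Fin M) : 0 ≤ gainPU h k m :=
  NNReal.coe_nonneg _

theorem gainSU_nonneg {K M : ℕ} (h : CSI K M) (k : Fin K) (m : Fin M) : 0 ≤ gainSU h k m :=
  NNReal.coe_nonneg _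

namespace Network

variable {K M : ℕ} (S : Network K M)

theorem ratePU_nonneg (k : Fin K) {x : ℝ} (hx : 0 ≤ x) : 0 ≤ S.ratePU k x :=
  Real.logb_nonneg one_lt_two (le_add_of_nonneg_right (div_nonneg (S.γ_nonneg k) (by linarith)))

theorem ratePU_antitone (k : Fin K) {x y : ℝ} (hx : 0 ≤ x) (hxy : x ≤ y) :
    S.ratePU k y ≤ S.ratePU k x := by
  have hγ := S.γ_nonneg k
  have hy : 0 ≤ y := hx.trans hxy
  refine Real.logb_le_logb_of_le one_lt_two (by positivity) ?_
  gcongr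

/-- On bounded intervals, the rate loss caused by the interference `x` is controlled by the loss
incurred between `x / 2` and `x`. -/
theorem ratePU_zero_sub_le (k : Fin K) {x X : ℝ} (hx : 0 ≤ x) (hxX : x ≤ X) :
    S.ratePU k 0 - S.ratePU k x ≤ 2 * (1 + X) * (S.ratePU k (x / 2) - S.ratePU k x) := by
  have hγ := S.γ_nonneg k
  set γ := S.γ k with hγdef
  have h2 : 0 < Real.log 2 := Real.log_pos one_lt_two
  have hlog : ∀ y, 0 ≤ y → S.ratePU k y - S.ratePU k x
      = Real.log ((1 + y + γ) * (1 + x) / ((1 + y) * (1 + x + γ))) / Real.log 2 := by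
    intro y hy
    rw [ratePU, ratePU, Real.logb, Real.logb, ← sub_div, ← Real.log_div (by positivity) (by positivity)]
    congr 2
    rw [← hγdef]
    field_simp
  rw [hlog 0 le_rfl, hlog (x / 2) (by positivity), ← mul_div_assoc]
  refine div_le_div_of_nonneg_right ?_ h2.le
  -- The bounds log t ≤ t - 1 and log t ≥ 1 - 1/t both produce numerators proportional to `γ * x`,
  -- which cancel in the comparison.
  have hu : Real.log ((1 + 0 + γ) * (1 + x) / ((1 + 0) * (1 + x + γ))) ≤ γ * x / (1 + x + γ) := by
    refine (Real.log_le_sub_one_of_pos (by positivity)).trans (le_of_eq ?_)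
    field_simp
    ring
  have hl : γ * x / (2 * (1 + x / 2 + γ) * (1 + x))
      ≤ Real.log ((1 + x / 2 + γ) * (1 + x) / ((1 + x / 2) * (1 + x + γ))) := by
    refine le_trans (le_of_eq ?_) (Real.one_sub_inv_le_log_of_pos (by positivity))
    field_simp
    ring
  refine hu.trans (le_trans ?_ (mul_le_mul_of_nonneg_left hl (by linarith)))
  rw [← mul_div_assoc, div_le_div_iff₀ (by positivity) (by positivity)]
  have h3 : (1 + x / 2 + γ) * (1 + x) ≤ (1 + X) * (1 + x + γ) := by
    rw [mul_comm (1 + X)]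
    gcongr
    linarith
  have := mul_le_mul_of_nonneg_left h3 (by positivity : 0 ≤ 2 * (γ * x))
  linarith

/-! ### Instantaneous Lagrangian and admissible allocations. -/

/-- The constraint part of the Lagrangian. -/
noncomputable def price (h : CSI K M) (lam : Multipliers K M) (x : Allocation K M) : ℝ :=
  ∑ m, lam.pi m * S.updatePi x m + ∑ k, lam.theta k * S.updateTheta h x k
    - ∑ k, lam.rho k * S.updateRho h x k

/-- Regrouped by band and user, the Lagrangian is linear in `w` with coefficients `quality`, up to a
term free of `x`; its maximization thus decouples over bands, then over users and powers. -/
theorem weightedRate_add_price (h : CSI K M) (lam : Multipliers K M) (x : Allocation K M) :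
    S.weightedRate h x + S.price h lam x
      = ∑ k, ∑ m, x.w k m * S.quality h lam k m (withVirtual (x.p k) m)
        + (∑ m, lam.pi m * S.maxAvgPower m + ∑ k, lam.theta k * (activity h k * S.maxInterf k)
          - ∑ k, lam.rho k * (activity h k * S.minRate k)) := by
  have hpi : ∑ m, lam.pi m * usedPower x m
      = ∑ k, ∑ m, x.w k m * (withVirtual lam.pi m * withVirtual (x.p k) m) := by
    simp only [usedPower, Finset.mul_sum, Fintype.sum_option, withVirtual, mul_zero, zero_add]
    rw [Finset.sum_comm]
    refine Finset.sum_congr rfl fun k _ => Finset.sum_congr rfl fun m _ => ?_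
    ring
  have hsplit : ∑ k, ∑ m, x.w k m * S.quality h lam k m (withVirtual (x.p k) m)
      = S.weightedRate h x - ∑ m, lam.pi m * usedPower x m
        - ∑ k, lam.theta k * (activity h k * interference h x k)
        + ∑ k, lam.rho k * (activity h k * S.primaryRate h x k) := by
    rw [hpi]
    simp only [weightedRate, interference, primaryRate, Finset.mul_sum, ← Finset.sum_sub_distrib,
      ← Finset.sum_add_distrib]
    refine Finset.sum_congr rfl fun k _ => Finset.sum_congr rfl fun m _ => ?_
    rw [quality]
    ring
  rw [hsplit]
  simp only [price, updatePi, updateTheta, updateRho, mul_sub, Finset.sum_sub_distrib]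
  ring

theorem Admissible.w_nonneg {h : CSI K M} {x : Allocation K M} (hx : S.Admissible h x) (k : Fin K)
    (m : Option (Fin M)) : 0 ≤ x.w k m := by
  rcases hx.binary k m with h | h <;> simp [h]

theorem Admissible.w_le_one {h : CSI K M} {x : Allocation K M} (hx : S.Admissible h x) (k : Fin K)
    (m : Option (Fin M)) : x.w k m ≤ 1 := by
  rcases hx.binary k m with h | h <;> simp [h]

theorem Admissible.sum_mul_le {h : CSI K M} {x : Allocation K M} (hx : S.Admissible h x) (k : Fin K)
    {f : Option (Fin M) → ℝ} {c : ℝ} (hf : ∀ m, x.w k m = 1 → f m ≤ c) :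
    ∑ m, x.w k m * f m ≤ c := by
  calc ∑ m, x.w k m * f m ≤ ∑ m, x.w k m * c := by
        refine Finset.sum_le_sum fun m _ => ?_
        rcases hx.binary k m with h | h
        · simp [h]
        · simpa [h] using hf m h
    _ = c := by rw [← Finset.sum_mul, hx.one_user, one_mul]

theorem Admissible.le_sum_mul {h : CSI K M} {x : Allocation K M} (hx : S.Admissible h x) (k : Fin K)
    {f : Option (Fin M) → ℝ} {c : ℝ} (hf : ∀ m, x.w k m = 1 → c ≤ f m) :
    c ≤ ∑ m, x.w k m * f m := by
  have := hx.sum_mul_le S k (f := fun m => -f m) (c := -c) fun m hm => neg_le_neg (hf m hm)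
  simp only [mul_neg, Finset.sum_neg_distrib] at this
  linarith

theorem Admissible.power_nonneg {h : CSI K M} {x : Allocation K M} (hx : S.Admissible h x)
    (k : Fin K) (m : Option (Fin M)) : 0 ≤ withVirtual (x.p k) m :=
  withVirtual_nonneg (fun m => (hx.power_mem k m).1) m

theorem Admissible.interf_nonneg {h : CSI K M} {x : Allocation K M} (hx : S.Admissible h x)
    (k : Fin K) (m : Option (Fin M)) :
    0 ≤ withVirtual (gainPU h k) m * withVirtual (x.p k) m :=
  mul_nonneg (withVirtual_nonneg (gainPU_nonneg h k) m) (hx.power_nonneg S k m)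

/-- The dual allocation maximizes the Lagrangian over all admissible allocations. -/
theorem IsDualAllocation.lagrangian_le {h : CSI K M} {lam : Multipliers K M} {x y : Allocation K M}
    (hx : S.IsDualAllocation h lam x) (hy : S.Admissible h y) :
    S.weightedRate h y + S.price h lam y ≤ S.weightedRate h x + S.price h lam x := by
  rw [weightedRate_add_price, weightedRate_add_price]
  gcongr ?_ + _
  refine Finset.sum_le_sum fun k _ => hy.sum_mul_le S k fun l _ => ?_
  refine hx.admissible.le_sum_mul S k fun m hm => ?_
  refine le_trans ?_ (hx.winner_max k m hm l)
  cases l with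
  | none => exact le_rfl
  | some l => exact hx.power_max k l _ (hy.power_mem k l)

theorem usedPower_nonneg {h : CSI K M} {x : Allocation K M} (hx : S.Admissible h x) (m : Fin M) :
    0 ≤ usedPower x m :=
  Finset.sum_nonneg fun k _ => mul_nonneg (hx.w_nonneg S k _) (hx.power_mem k m).1

theorem usedPower_le {h : CSI K M} {x : Allocation K M} (hx : S.Admissible h x) (m : Fin M) :
    usedPower x m ≤ ∑ k, S.ampMax k m :=
  Finset.sum_le_sum fun k _ => (mul_le_of_le_one_left (hx.power_mem k m).1 (hx.w_le_one S k _)).trans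
    ((hx.power_mem k m).2.trans (S.peak_le h k m))

theorem interference_nonneg {h : CSI K M} {x : Allocation K M} (hx : S.Admissible h x) (k : Fin K) :
    0 ≤ interference h x k :=
  hx.le_sum_mul S k fun m _ => hx.interf_nonneg S k m

theorem primaryRate_nonneg {h : CSI K M} {x : Allocation K M} (hx : S.Admissible h x) (k : Fin K) :
    0 ≤ S.primaryRate h x k :=
  hx.le_sum_mul S k fun m _ => S.ratePU_nonneg k (hx.interf_nonneg S k m)

theorem primaryRate_le {h : CSI K M} {x : Allocation K M} (hx : S.Admissible h x) (k : Fin K) :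
    S.primaryRate h x k ≤ S.ratePU k 0 :=
  hx.sum_mul_le S k fun m _ => S.ratePU_antitone k le_rfl (hx.interf_nonneg S k m)

/-- The weighted sum-rate when all users transmit at peak power in all bands. -/
noncomputable def peakRate (h : CSI K M) : ℝ := ∑ k, ∑ m, S.β m * rateSU (gainSU h k m * S.peak h k m)

theorem weightedRate_nonneg {h : CSI K M} {x : Allocation K M} (hx : S.Admissible h x) :
    0 ≤ S.weightedRate h x := by
  refine Finset.sum_nonneg fun k _ => Finset.sum_nonneg fun m _ => ?_
  refine mul_nonneg (mul_nonneg (withVirtual_nonneg (fun m => (S.β_pos m).le) m)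
    (hx.w_nonneg S k m)) (rateSU_nonneg ?_)
  exact mul_nonneg (withVirtual_nonneg (gainSU_nonneg h k) m) (hx.power_nonneg S k m)

theorem weightedRate_le_peakRate {h : CSI K M} {x : Allocation K M} (hx : S.Admissible h x) :
    S.weightedRate h x ≤ S.peakRate h := by
  refine Finset.sum_le_sum fun k _ => ?_
  rw [Fintype.sum_option]
  simp only [withVirtual, zero_mul, zero_add]
  refine Finset.sum_le_sum fun m _ => ?_
  have hp := hx.power_mem k m
  have hg := gainSU_nonneg h k m
  refine mul_le_mul (mul_le_of_le_one_right (S.β_pos m).le (hx.w_le_one S k _))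
    (rateSU_mono (mul_nonneg hg hp.1) (mul_le_mul_of_nonneg_left hp.2 hg))
    (rateSU_nonneg (mul_nonneg hg hp.1)) (S.β_pos m).le

/-- The allocation in which the virtual user gets all bands. -/
noncomputable def idle (K M : ℕ) : Allocation K M where
  w _ m := if m = none then 1 else 0
  p _ _ := 0

theorem admissible_idle (h : CSI K M) : S.Admissible h (idle K M) where
  binary k m := by unfold idle; dsimp only; split_ifs <;> simp
  one_user k := by simp [idle]
  power_mem k m := ⟨le_rfl, S.peak_nonneg h k m⟩

theorem usedPower_idle (m : Fin M) : usedPower (idle K M) m = 0 := by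
  simp [usedPower, idle]

theorem withVirtual_zero (m : Option (Fin M)) : withVirtual (fun _ => 0) m = 0 := by
  cases m <;> rfl

theorem interference_idle (h : CSI K M) (k : Fin K) : interference h (idle K M) k = 0 := by
  simp [interference, idle, withVirtual_zero]

theorem primaryRate_idle (h : CSI K M) (k : Fin K) :
    S.primaryRate h (idle K M) k = S.ratePU k 0 := by
  simp [primaryRate, idle, withVirtual_zero]

theorem weightedRate_idle (h : CSI K M) : S.weightedRate h (idle K M) = 0 := by
  simp [weightedRate, idle, withVirtual_zero, rateSU]

/-! ### Bounds on multiplier times consumption. -/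

/-- All multipliers are nonnegative. -/
structure _root_.CognitiveRadio.Multipliers.Nonneg (lam : Multipliers K M) : Prop where
  pi : ∀ m, 0 ≤ lam.pi m
  theta : ∀ k, 0 ≤ lam.theta k
  rho : ∀ k, 0 ≤ lam.rho k

/-- Comparison of a power of the dual allocation with half of it. -/
theorem IsDualAllocation.half_power {h : CSI K M} {lam : Multipliers K M} {x : Allocation K M}
    (hx : S.IsDualAllocation h lam x) (k : Fin K) (m : Fin M) :
    lam.pi m * x.p k m / 2 + lam.theta k * activity h k * (gainPU h k m * x.p k m) / 2
      + lam.rho k * activity h k * (S.ratePU k (gainPU h k m * x.p k m / 2)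
        - S.ratePU k (gainPU h k m * x.p k m)) ≤ S.β m := by
  have hp := hx.admissible.power_mem k m
  have h1 := hx.power_max k m (x.p k m / 2) ⟨by linarith [hp.1], by linarith [hp.1, hp.2]⟩
  have h2 := mul_le_mul_of_nonneg_left
    (rateSU_le_rateSU_half_add_one (mul_nonneg (gainSU_nonneg h k m) hp.1)) (S.β_pos m).le
  simp only [quality, withVirtual, ← mul_div_assoc] at h1
  linarith

/-- All three terms in `half_power` are nonnegative, so each alone is at most `S.β m`; this uses the
first, in every band. -/
theorem IsDualAllocation.pi_mul_usedPower_le {h : CSI K M} {lam : Multipliers K M}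
    {x : Allocation K M} (hx : S.IsDualAllocation h lam x) (hlam : lam.Nonneg) (m : Fin M) :
    lam.pi m * usedPower x m ≤ K * (2 * S.β m) := by
  have h1 : ∀ k, lam.pi m * (x.w k (some m) * x.p k m) ≤ 2 * S.β m := by
    intro k
    have h2 := hx.half_power S k m
    have hp := (hx.admissible.power_mem k m).1
    have hgp := mul_nonneg (gainPU_nonneg h k m) hp
    have h3 : 0 ≤ lam.theta k * activity h k * (gainPU h k m * x.p k m) :=
      mul_nonneg (mul_nonneg (hlam.theta k) (activity_nonneg h k)) hgp
    have h4 : 0 ≤ lam.rho k * activity h k * (S.ratePU k (gainPU h k m * x.p k m / 2)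
        - S.ratePU k (gainPU h k m * x.p k m)) :=
      mul_nonneg (mul_nonneg (hlam.rho k) (activity_nonneg h k))
        (sub_nonneg.2 (S.ratePU_antitone k (by linarith) (by linarith)))
    have h5 : lam.pi m * (x.w k (some m) * x.p k m) ≤ lam.pi m * x.p k m :=
      mul_le_mul_of_nonneg_left (mul_le_of_le_one_left hp (hx.admissible.w_le_one S k _)) (hlam.pi m)
    linarith
  rw [usedPower, Finset.mul_sum]
  refine (Finset.sum_le_sum fun k _ => h1 k).trans (le_of_eq ?_)
  simp

theorem β_le_sum (m : Fin M) : S.β m ≤ ∑ l, S.β l :=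
  Finset.single_le_sum (fun l _ => (S.β_pos l).le) (Finset.mem_univ m)

theorem sum_β_nonneg : 0 ≤ ∑ m, S.β m := Finset.sum_nonneg fun m _ => (S.β_pos m).le

theorem IsDualAllocation.theta_mul_interference_le {h : CSI K M} {lam : Multipliers K M}
    {x : Allocation K M} (hx : S.IsDualAllocation h lam x) (hlam : lam.Nonneg) (k : Fin K) :
    lam.theta k * (activity h k * interference h x k) ≤ 2 * (∑ m, S.β m) * activity h k := by
  rcases activity_eq_zero_or_one h k with ha | ha
  · simp [ha]
  rw [ha, one_mul, mul_one, interference, Finset.mul_sum]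
  simp only [mul_left_comm (lam.theta k)]
  refine hx.admissible.sum_mul_le S k fun m _ => ?_
  cases m with
  | none =>
    simp only [withVirtual, mul_zero]
    exact mul_nonneg zero_le_two S.sum_β_nonneg
  | some m =>
    have h2 := hx.half_power S k m
    have hp := (hx.admissible.power_mem k m).1
    have hgp := mul_nonneg (gainPU_nonneg h k m) hp
    have h3 : 0 ≤ lam.pi m * x.p k m := mul_nonneg (hlam.pi m) hp
    have h4 : 0 ≤ lam.rho k * (S.ratePU k (gainPU h k m * x.p k m / 2)
        - S.ratePU k (gainPU h k m * x.p k m)) :=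
      mul_nonneg (hlam.rho k) (sub_nonneg.2 (S.ratePU_antitone k (by linarith) (by linarith)))
    simp only [ha, mul_one] at h2
    simp only [withVirtual]
    linarith [S.β_le_sum m]

/-- `half_power` controls only the rate loss between half and full interference;
`ratePU_zero_sub_le` extends this to the whole loss, at a factor depending on the interference bound
`X`. -/
theorem IsDualAllocation.rho_mul_rate_loss_le {h : CSI K M} {lam : Multipliers K M}
    {x : Allocation K M} (hx : S.IsDualAllocation h lam x) (hlam : lam.Nonneg) (k : Fin K)
    {X : ℝ} (hX0 : 0 ≤ X) (hX : activity h k * interference h x k ≤ X) :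
    lam.rho k * (activity h k * (S.ratePU k 0 - S.primaryRate h x k))
      ≤ 2 * (1 + X) * (∑ m, S.β m) * activity h k := by
  rcases activity_eq_zero_or_one h k with ha | ha
  · simp [ha]
  rw [ha, one_mul] at hX
  have h1 : S.ratePU k 0 - S.primaryRate h x k = ∑ m, x.w k m *
      (S.ratePU k 0 - S.ratePU k (withVirtual (gainPU h k) m * withVirtual (x.p k) m)) := by
    simp only [mul_sub, Finset.sum_sub_distrib, ← Finset.sum_mul, hx.admissible.one_user, one_mul,
      primaryRate]
  rw [h1, ha, one_mul, mul_one, Finset.mul_sum]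
  simp only [mul_left_comm (lam.rho k)]
  have hb := S.sum_β_nonneg
  refine hx.admissible.sum_mul_le S k fun m hm => ?_
  cases m with
  | none => simp only [withVirtual, mul_zero, sub_self]; positivity
  | some m =>
    have h2 := hx.half_power S k m
    have hp := (hx.admissible.power_mem k m).1
    have hgp := mul_nonneg (gainPU_nonneg h k m) hp
    have hgX : gainPU h k m * x.p k m ≤ X := by
      refine le_trans ?_ hX
      have := Finset.single_le_sum (f := fun m => x.w k m *
        (withVirtual (gainPU h k) m * withVirtual (x.p k) m))
        (fun m _ => mul_nonneg (hx.admissible.w_nonneg S k m) (hx.admissible.interf_nonneg S k m))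
        (Finset.mem_univ (some m))
      rw [hm, one_mul] at this
      exact this
    have h3 : 0 ≤ lam.pi m * x.p k m := mul_nonneg (hlam.pi m) hp
    have h4 : 0 ≤ lam.theta k * (gainPU h k m * x.p k m) := mul_nonneg (hlam.theta k) hgp
    simp only [ha, mul_one] at h2
    have h5 := mul_le_mul_of_nonneg_left (S.ratePU_zero_sub_le k hgp hgX) (hlam.rho k)
    have h6 : lam.rho k * (S.ratePU k (gainPU h k m * x.p k m / 2)
        - S.ratePU k (gainPU h k m * x.p k m)) ≤ ∑ m, S.β m := by
      linarith [S.β_le_sum m]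
    have h7 := mul_le_mul_of_nonneg_left h6 (by positivity : 0 ≤ 2 * (1 + X))
    simp only [withVirtual]
    linarith

end Network

/-! ### Energy drift along a run. -/

namespace Network

variable {K M : ℕ} (S : Network K M)

/-- The quadratic Lyapunov function of the dual iterations. -/
noncomputable def energy (ηπ ηθ ηρ : ℝ) (lam : Multipliers K M) : ℝ :=
  ∑ m, lam.pi m ^ 2 / (2 * ηπ) + ∑ k, lam.theta k ^ 2 / (2 * ηθ) + ∑ k, lam.rho k ^ 2 / (2 * ηρ)

section Run

variable {S} {ηπ ηθ ηρ η G : ℝ} {h : ℕ → CSI K M} {lam : ℕ → Multipliers K M}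
  {x : ℕ → Allocation K M}

theorem IsStochasticRA.nonneg (run : S.IsStochasticRA ηπ ηθ ηρ h lam x) (n : ℕ) :
    (lam n).Nonneg := by
  cases n with
  | zero => exact ⟨run.pi_init, run.theta_init, run.rho_init⟩
  | succ n =>
    refine ⟨fun m => ?_, fun k => ?_, fun k => ?_⟩
    · rw [run.pi_step]; exact le_max_right _ _
    · rw [run.theta_step]; exact le_max_right _ _
    · rw [run.rho_step]; exact le_max_right _ _

theorem IsStochasticRA.rho_step' (run : S.IsStochasticRA ηπ ηθ ηρ h lam x) (n : ℕ) (k : Fin K) :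
    (lam (n + 1)).rho k = max ((lam n).rho k - ηρ * -S.updateRho (h n) (x n) k) 0 := by
  rw [run.rho_step, mul_neg, sub_neg_eq_add]

/-- The linear terms of `projected_step_sq_le`, summed over the `M + 2 * K` multipliers, are exactly
the price. -/
theorem IsStochasticRA.energy_succ_le (run : S.IsStochasticRA ηπ ηθ ηρ h lam x)
    (bdd : S.BoundedUpdates G h x) (hπ : 0 < ηπ) (hθ : 0 < ηθ) (hρ : 0 < ηρ) (hπη : ηπ ≤ η)
    (hθη : ηθ ≤ η) (hρη : ηρ ≤ η) (n : ℕ) :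
    energy ηπ ηθ ηρ (lam (n + 1)) + S.price (h n) (lam n) (x n)
      ≤ energy ηπ ηθ ηρ (lam n) + (M + 2 * K) * (η * G ^ 2 / 2) := by
  have h1 : ∑ m, (lam (n + 1)).pi m ^ 2 / (2 * ηπ) ≤ ∑ m, ((lam n).pi m ^ 2 / (2 * ηπ)
      - (lam n).pi m * S.updatePi (x n) m + η * G ^ 2 / 2) := Finset.sum_le_sum fun m _ => by
    rw [run.pi_step]; exact projected_step_sq_le hπ hπη (bdd.pi_bdd n m)
  have h2 : ∑ k, (lam (n + 1)).theta k ^ 2 / (2 * ηθ) ≤ ∑ k, ((lam n).theta k ^ 2 / (2 * ηθ)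
      - (lam n).theta k * S.updateTheta (h n) (x n) k + η * G ^ 2 / 2) :=
    Finset.sum_le_sum fun k _ => by
      rw [run.theta_step]; exact projected_step_sq_le hθ hθη (bdd.theta_bdd n k)
  have h3 : ∑ k, (lam (n + 1)).rho k ^ 2 / (2 * ηρ) ≤ ∑ k, ((lam n).rho k ^ 2 / (2 * ηρ)
      - (lam n).rho k * -S.updateRho (h n) (x n) k + η * G ^ 2 / 2) :=
    Finset.sum_le_sum fun k _ => by
      rw [run.rho_step']
      exact projected_step_sq_le hρ hρη (by rw [abs_neg]; exact bdd.rho_bdd n k)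
  simp only [Finset.sum_add_distrib, Finset.sum_sub_distrib, Finset.sum_const, Finset.card_univ,
    Fintype.card_fin, nsmul_eq_mul, mul_neg, Finset.sum_neg_distrib] at h1 h2 h3
  simp only [energy, price]
  linarith

/-- The energy of the multipliers compares the rates of the run with the Lagrangian of any other
admissible allocation. -/
theorem IsStochasticRA.energy_add_sum_le (run : S.IsStochasticRA ηπ ηθ ηρ h lam x)
    (bdd : S.BoundedUpdates G h x) (hπ : 0 < ηπ) (hθ : 0 < ηθ) (hρ : 0 < ηρ) (hπη : ηπ ≤ η)
    (hθη : ηθ ≤ η) (hρη : ηρ ≤ η) {y : ℕ → Allocation K M} (hy : ∀ n, S.Admissible (h n) (y n))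
    (n : ℕ) :
    energy ηπ ηθ ηρ (lam n) + ∑ l ∈ Finset.range n, S.weightedRate (h l) (y l)
        + ∑ l ∈ Finset.range n, S.price (h l) (lam l) (y l)
      ≤ energy ηπ ηθ ηρ (lam 0) + ∑ l ∈ Finset.range n, S.weightedRate (h l) (x l)
        + n * ((M + 2 * K) * (η * G ^ 2 / 2)) := by
  induction n with
  | zero => simp
  | succ n ih =>
    simp only [Finset.sum_range_succ]
    push_cast
    linarith [run.energy_succ_le bdd hπ hθ hρ hπη hθη hρη n, (run.allocation n).lagrangian_le S (hy n)]

theorem energy_nonneg (hπ : 0 < ηπ) (hθ : 0 < ηθ) (hρ : 0 < ηρ) (l : Multipliers K M) :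
    0 ≤ energy ηπ ηθ ηρ l := by
  unfold energy; positivity

theorem pi_sq_le_energy (hπ : 0 < ηπ) (hθ : 0 < ηθ) (hρ : 0 < ηρ) (l : Multipliers K M)
    (m : Fin M) : l.pi m ^ 2 ≤ 2 * ηπ * energy ηπ ηθ ηρ l := by
  have h1 : l.pi m ^ 2 / (2 * ηπ) ≤ ∑ m, l.pi m ^ 2 / (2 * ηπ) :=
    Finset.single_le_sum (f := fun m => l.pi m ^ 2 / (2 * ηπ)) (fun m _ => by positivity)
      (Finset.mem_univ m)
  have h2 : 0 ≤ ∑ k, l.theta k ^ 2 / (2 * ηθ) := by positivity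
  have h3 : 0 ≤ ∑ k, l.rho k ^ 2 / (2 * ηρ) := by positivity
  rw [div_le_iff₀ (by positivity)] at h1
  refine h1.trans ?_
  rw [mul_comm, energy]
  gcongr
  linarith

theorem theta_sq_le_energy (hπ : 0 < ηπ) (hθ : 0 < ηθ) (hρ : 0 < ηρ) (l : Multipliers K M)
    (k : Fin K) : l.theta k ^ 2 ≤ 2 * ηθ * energy ηπ ηθ ηρ l := by
  have h1 : l.theta k ^ 2 / (2 * ηθ) ≤ ∑ k, l.theta k ^ 2 / (2 * ηθ) :=
    Finset.single_le_sum (f := fun k => l.theta k ^ 2 / (2 * ηθ)) (fun m _ => by positivity)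
      (Finset.mem_univ k)
  have h2 : 0 ≤ ∑ m, l.pi m ^ 2 / (2 * ηπ) := by positivity
  have h3 : 0 ≤ ∑ k, l.rho k ^ 2 / (2 * ηρ) := by positivity
  rw [div_le_iff₀ (by positivity)] at h1
  refine h1.trans ?_
  rw [mul_comm, energy]
  gcongr
  linarith

theorem rho_sq_le_energy (hπ : 0 < ηπ) (hθ : 0 < ηθ) (hρ : 0 < ηρ) (l : Multipliers K M)
    (k : Fin K) : l.rho k ^ 2 ≤ 2 * ηρ * energy ηπ ηθ ηρ l := by
  have h1 : l.rho k ^ 2 / (2 * ηρ) ≤ ∑ k, l.rho k ^ 2 / (2 * ηρ) :=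
    Finset.single_le_sum (f := fun k => l.rho k ^ 2 / (2 * ηρ)) (fun m _ => by positivity)
      (Finset.mem_univ k)
  have h2 : 0 ≤ ∑ m, l.pi m ^ 2 / (2 * ηπ) := by positivity
  have h3 : 0 ≤ ∑ k, l.theta k ^ 2 / (2 * ηθ) := by positivity
  rw [div_le_iff₀ (by positivity)] at h1
  refine h1.trans ?_
  rw [mul_comm, energy]
  gcongr
  linarith

/-- Along a channel realization for which the idle allocation meets all constraints, the energy
grows at most linearly. -/
theorem IsStochasticRA.exists_energy_le (run : S.IsStochasticRA ηπ ηθ ηρ h lam x)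
    (bdd : S.BoundedUpdates G h x) (hπ : 0 < ηπ) (hθ : 0 < ηθ) (hρ : 0 < ηρ)
    (hP : ∀ m, 0 ≤ S.maxAvgPower m) (hI : ∀ l k, 0 ≤ activity (h l) k * S.maxInterf k)
    (hr : ∀ l k, 0 ≤ activity (h l) k * (S.ratePU k 0 - S.minRate k)) {F : ℝ}
    (hF : Tendsto (sampleAverage fun l => S.peakRate (h l)) atTop (𝓝 F)) :
    ∃ D, ∀ᶠ n : ℕ in atTop, energy ηπ ηθ ηρ (lam n) ≤ D * n := by
  set η := max ηπ (max ηθ ηρ) with hη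
  refine ⟨energy ηπ ηθ ηρ (lam 0) + (F + 1) + (M + 2 * K) * (η * G ^ 2 / 2), ?_⟩
  filter_upwards [hF.eventually_lt_const (lt_add_one F), eventually_ge_atTop 1] with n hn hn1
  have hn1' : (1 : ℝ) ≤ n := by exact_mod_cast hn1
  have h1 := run.energy_add_sum_le bdd hπ hθ hρ (η := η) (le_max_left _ _)
    ((le_max_left _ _).trans (le_max_right _ _)) ((le_max_right _ _).trans (le_max_right _ _))
    (y := fun _ => idle K M) (fun n => S.admissible_idle (h n)) n
  have h2 : 0 ≤ ∑ l ∈ Finset.range n, S.price (h l) (lam l) (idle K M) := by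
    refine Finset.sum_nonneg fun l _ => ?_
    have hl := run.nonneg l
    have h3 : 0 ≤ ∑ m, (lam l).pi m * S.updatePi (idle K M) m := Finset.sum_nonneg fun m _ => by
      rw [updatePi, usedPower_idle, sub_zero]
      exact mul_nonneg (hl.pi m) (hP m)
    have h4 : 0 ≤ ∑ k, (lam l).theta k * S.updateTheta (h l) (idle K M) k :=
      Finset.sum_nonneg fun k _ => by
        rw [updateTheta, interference_idle, sub_zero]
        exact mul_nonneg (hl.theta k) (hI l k)
    have h5 : ∑ k, (lam l).rho k * S.updateRho (h l) (idle K M) k ≤ 0 :=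
      Finset.sum_nonpos fun k _ => by
        rw [updateRho, primaryRate_idle]
        refine mul_nonpos_of_nonneg_of_nonpos (hl.rho k) ?_
        linarith [hr l k]
    rw [price]
    linarith
  have h6 : ∑ l ∈ Finset.range n, S.weightedRate (h l) (x l) ≤ (F + 1) * n := by
    rw [sampleAverage, div_lt_iff₀ (by linarith)] at hn
    exact (Finset.sum_le_sum fun l _ =>
      S.weightedRate_le_peakRate (run.allocation l).admissible).trans hn.le
  have h7 : energy ηπ ηθ ηρ (lam 0) ≤ energy ηπ ηθ ηρ (lam 0) * n :=
    le_mul_of_one_le_right (energy_nonneg hπ hθ hρ _) hn1'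
  simp only [weightedRate_idle, Finset.sum_const_zero, add_zero] at h1
  linarith

/-- Each squared multiplier is at most a constant times the energy, hence O(n), so the multipliers
are O(√n). -/
theorem IsStochasticRA.tendsto_multipliers_div (run : S.IsStochasticRA ηπ ηθ ηρ h lam x)
    (bdd : S.BoundedUpdates G h x) (hπ : 0 < ηπ) (hθ : 0 < ηθ) (hρ : 0 < ηρ)
    (hP : ∀ m, 0 ≤ S.maxAvgPower m) (hI : ∀ l k, 0 ≤ activity (h l) k * S.maxInterf k)
    (hr : ∀ l k, 0 ≤ activity (h l) k * (S.ratePU k 0 - S.minRate k)) {F : ℝ}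
    (hF : Tendsto (sampleAverage fun l => S.peakRate (h l)) atTop (𝓝 F)) :
    (∀ m, Tendsto (fun n : ℕ => (lam n).pi m / n) atTop (𝓝 0)) ∧
    (∀ k, Tendsto (fun n : ℕ => (lam n).theta k / n) atTop (𝓝 0)) ∧
    (∀ k, Tendsto (fun n : ℕ => (lam n).rho k / n) atTop (𝓝 0)) := by
  obtain ⟨D, hD⟩ := run.exists_energy_le bdd hπ hθ hρ hP hI hr hF
  refine ⟨fun m => ?_, fun k => ?_, fun k => ?_⟩
  · refine tendsto_div_of_sq_le (D := 2 * ηπ * D) (fun n => (run.nonneg n).pi m) ?_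
    filter_upwards [hD] with n hn
    refine (pi_sq_le_energy hπ hθ hρ _ m).trans ?_
    rw [mul_assoc _ D]
    gcongr
  · refine tendsto_div_of_sq_le (D := 2 * ηθ * D) (fun n => (run.nonneg n).theta k) ?_
    filter_upwards [hD] with n hn
    refine (theta_sq_le_energy hπ hθ hρ _ k).trans ?_
    rw [mul_assoc _ D]
    gcongr
  · refine tendsto_div_of_sq_le (D := 2 * ηρ * D) (fun n => (run.nonneg n).rho k) ?_
    filter_upwards [hD] with n hn
    refine (rho_sq_le_energy hπ hθ hρ _ k).trans ?_
    rw [mul_assoc _ D]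
    gcongr

end Run

end Network

/-! ### Slack of a feasible policy. -/

section Budget

variable {α : Type*} [MeasurableSpace α] {ν : Measure α} {ind c : α → ℝ} {b : ℝ}

theorem ae_eq_zero_of_integral_nonpos {f : α → ℝ} (hf : Integrable f ν) (hf0 : ∀ s, 0 ≤ f s)
    (h : ∫ s, f s ∂ν ≤ 0) : ∀ᵐ s ∂ν, f s = 0 :=
  (integral_eq_zero_iff_of_nonneg hf0 hf).1 (le_antisymm h (integral_nonneg hf0))

/-- A negative `b` is compatible with the hypothesis only if `ind` vanishes almost everywhere. -/
theorem ae_nonneg_mul_of_integral_mul_nonneg (hind : Integrable ind ν) (hind0 : ∀ s, 0 ≤ ind s)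
    (h : 0 ≤ (∫ s, ind s ∂ν) * b) : ∀ᵐ s ∂ν, 0 ≤ ind s * b := by
  rcases le_or_gt 0 b with hb | hb
  · exact Eventually.of_forall fun s => mul_nonneg (hind0 s) hb
  · filter_upwards [ae_eq_zero_of_integral_nonpos hind hind0 (nonpos_of_mul_nonneg_left h hb)]
      with s hs
    simp [hs]

/-- A nonnegative consumption which respects a budget on average either has a strictly positive
budget or uses it up almost surely. -/
theorem budget_pos_or_ae_eq_zero (hind : Integrable ind ν) (hind0 : ∀ s, 0 ≤ ind s)
    (hc : Integrable c ν) (hc0 : ∀ s, 0 ≤ c s) (h : ∫ s, c s ∂ν ≤ (∫ s, ind s ∂ν) * b) :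
    (0 < ∫ s, ind s ∂ν ∧ 0 < b) ∨ ∀ᵐ s ∂ν, b * ind s - c s = 0 := by
  have hi0 : 0 ≤ ∫ s, ind s ∂ν := integral_nonneg hind0
  have hci0 : 0 ≤ ∫ s, c s ∂ν := integral_nonneg hc0
  rcases hi0.eq_or_lt with hi | hi
  · right
    rw [← hi, zero_mul] at h
    filter_upwards [ae_eq_zero_of_integral_nonpos hind hind0 hi.ge,
      ae_eq_zero_of_integral_nonpos hc hc0 h] with s h1 h2
    simp [h1, h2]
  · rcases lt_or_ge 0 b with hb | hb
    · exact Or.inl ⟨hi, hb⟩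
    · right
      have hb0 : 0 ≤ b := le_of_mul_le_mul_left (by linarith) hi
      have hb' : b = 0 := le_antisymm hb hb0
      rw [hb', mul_zero] at h
      filter_upwards [ae_eq_zero_of_integral_nonpos hc hc0 h] with s h2
      simp [h2, hb']

/-- Long-term average of a dual multiplier against the slack which a feasible policy leaves in the
corresponding constraint. Here `ind` marks the channel states in which the constraint is active, `b`
is the budget, `c` the consumption of the policy, and `d` the consumption along the run. -/
theorem IsStationaryErgodic.eventually_neg_le_sampleAverage_slack {Ω : Type*} [MeasurableSpace Ω]
    {μ : Measure Ω} [IsProbabilityMeasure μ] {h : ℕ → Ω → α} (hmeas : ∀ n, Measurable (h n))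
    (hstat : IsStationaryErgodic μ h) (hindm : Measurable ind)
    (hind : Integrable ind (μ.map (h 0))) (hind0 : ∀ s, 0 ≤ ind s) (hcm : Measurable c)
    (hc : Integrable c (μ.map (h 0))) (hc0 : ∀ s, 0 ≤ c s)
    (hbudget : ∫ s, c s ∂(μ.map (h 0)) ≤ (∫ s, ind s ∂(μ.map (h 0))) * b)
    {C G δ : ℝ} (hC : 0 ≤ C) (hG : 0 ≤ G) (hδ : 0 < δ) :
    ∀ᶠ η₀ in 𝓝[>] (0 : ℝ), ∀ᵐ ω ∂μ, ∀ e η, 0 < e → e ≤ η → η ≤ η₀ → ∀ lam g d : ℕ → ℝ,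
      (∀ l, 0 ≤ lam l) → (∀ l, g l = b * ind (h l ω) - d l) → (∀ l, |g l| ≤ G) →
      (∀ l, lam (l + 1) = max (lam l - e * g l) 0) → (∀ l, lam l * d l ≤ C * ind (h l ω)) →
      ∀ᶠ n in atTop,
        -δ ≤ sampleAverage (fun l => lam l * (b * ind (h l ω) - c (h l ω))) n := by
  -- This dichotomy replaces a Slater condition: either the multiplier is eventually bounded, or it
  -- multiplies a slack that is zero along almost every path.
  rcases budget_pos_or_ae_eq_zero hind hind0 hc hc0 hbudget with ⟨hi, hb⟩ | hzero
  · have hint : 0 ≤ ∫ s, (b * ind s - c s) ∂(μ.map (h 0)) := by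
      rw [integral_sub (hind.const_mul b) hc, integral_const_mul]
      linarith
    obtain ⟨η₁, hη₁, hae⟩ := hstat.exists_stepsize_neg_le_sampleAverage_mul hmeas
      (u := fun s => b * ind s - c s) ((hindm.const_mul b).sub hcm) ((hind.const_mul b).sub hc) hint
      (B := 2 * C / b) (by positivity) hG hδ
    filter_upwards [Ioo_mem_nhdsGT hη₁] with η₀ hη₀
    filter_upwards [hae, hstat.ae_tendsto_sampleAverage hmeas hindm hind] with ω hω hind_avg
      e η he heη hηη₀ lam g d hlam hg hgG hstep hd
    refine hω η (he.trans_le heη) (hηη₀.trans_lt hη₀.2) lam hlam ?_ ?_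
    · exact eventually_multiplier_le hb hC he heη hlam (fun l => hind0 _) hd hg hgG hstep hi hind_avg
    · intro l
      rw [hstep]
      exact abs_projected_step_sub_le (hlam l) he heη (hgG l)
  · refine Eventually.of_forall fun η₀ => ?_
    filter_upwards [hstat.ae_forall hmeas hzero] with ω hω e η _ _ _ lam g d _ _ _ _ _
    refine Eventually.of_forall fun n => ?_
    simp only [hω, mul_zero]
    simp [sampleAverage, hδ.le]

end Budget

/-! ### Measurability, integrability and consequences of feasibility. -/

theorem measurable_activity {K M : ℕ} (k : Fin K) :
    Measurable fun h : CSI K M => activity h k :=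
  (Measurable.of_discrete (f := fun b : Bool => if b = true then (1 : ℝ) else 0)).comp
    ((measurable_pi_apply k).comp measurable_fst)

theorem measurable_withVirtual_gainPU {K M : ℕ} (k : Fin K) (m : Option (Fin M)) :
    Measurable fun h : CSI K M => withVirtual (gainPU h k) m := by
  cases m with
  | none => exact measurable_const
  | some m =>
    have : Measurable fun h : CSI K M => h.2.1 k m := by fun_prop
    exact this.coe_nnreal_real

theorem measurable_withVirtual_gainSU {K M : ℕ} (k : Fin K) (m : Option (Fin M)) :
    Measurable fun h : CSI K M => withVirtual (gainSU h k) m := by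
  cases m with
  | none => exact measurable_const
  | some m =>
    have : Measurable fun h : CSI K M => h.2.2 k m := by fun_prop
    exact this.coe_nnreal_real

theorem measurable_rateSU : Measurable rateSU := by
  unfold rateSU Real.logb
  fun_prop

theorem integrable_activity {K M : ℕ} (ν : Measure (CSI K M)) [IsFiniteMeasure ν] (k : Fin K) :
    Integrable (fun h => activity h k) ν :=
  Integrable.of_bound (measurable_activity k).aestronglyMeasurable 1
    (Eventually.of_forall fun h => by
      rw [Real.norm_eq_abs, abs_of_nonneg (activity_nonneg h k)]; exact activity_le_one h k)

namespace Network

variable {K M : ℕ} (S : Network K M)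

theorem measurable_ratePU (k : Fin K) : Measurable (S.ratePU k) := by
  unfold ratePU Real.logb
  fun_prop

theorem measurable_peakRate : Measurable S.peakRate := by
  refine Finset.measurable_sum _ fun k _ => Finset.measurable_sum _ fun m _ => ?_
  exact (measurable_rateSU.comp ((measurable_withVirtual_gainSU k (some m)).mul
    (S.measurable_peak k m))).const_mul _

theorem integrable_peakRate {ν : Measure (CSI K M)}
    (hcap : ∀ k m, Integrable (fun c => rateSU (gainSU c k m * S.peak c k m)) ν) :
    Integrable S.peakRate ν :=
  integrable_finsetSum _ fun k _ => integrable_finsetSum _ fun m _ => (hcap k m).const_mul _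

section Feasible

variable {S} {ν : Measure (CSI K M)} {z : CSI K M → Allocation K M}

theorem Feasible.measurable_withVirtual_p (hz : S.Feasible ν z) (k : Fin K) (m : Option (Fin M)) :
    Measurable fun h => withVirtual ((z h).p k) m := by
  cases m with
  | none => exact measurable_const
  | some m => exact hz.measurable_p k m

theorem Feasible.measurable_usedPower (hz : S.Feasible ν z) (m : Fin M) :
    Measurable fun h => usedPower (z h) m :=
  Finset.measurable_sum _ fun k _ => (hz.measurable_w k _).mul (hz.measurable_p k m)

theorem Feasible.measurable_interference (hz : S.Feasible ν z) (k : Fin K) :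
    Measurable fun h => interference h (z h) k :=
  Finset.measurable_sum _ fun m _ => (hz.measurable_w k m).mul
    ((measurable_withVirtual_gainPU k m).mul (hz.measurable_withVirtual_p k m))

theorem Feasible.measurable_primaryRate (hz : S.Feasible ν z) (k : Fin K) :
    Measurable fun h => S.primaryRate h (z h) k :=
  Finset.measurable_sum _ fun m _ => (hz.measurable_w k m).mul ((S.measurable_ratePU k).comp
    ((measurable_withVirtual_gainPU k m).mul (hz.measurable_withVirtual_p k m)))

theorem Feasible.measurable_weightedRate (hz : S.Feasible ν z) :
    Measurable fun h => S.weightedRate h (z h) :=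
  Finset.measurable_sum _ fun k _ => Finset.measurable_sum _ fun m _ =>
    ((hz.measurable_w k m).const_mul _).mul (measurable_rateSU.comp
      ((measurable_withVirtual_gainSU k m).mul (hz.measurable_withVirtual_p k m)))

theorem Feasible.integrable_usedPower [IsFiniteMeasure ν] (hz : S.Feasible ν z) (m : Fin M) :
    Integrable (fun h => usedPower (z h) m) ν :=
  Integrable.of_bound (hz.measurable_usedPower m).aestronglyMeasurable (∑ k, S.ampMax k m)
    (Eventually.of_forall fun h => by
      rw [Real.norm_eq_abs, abs_of_nonneg (S.usedPower_nonneg (hz.admissible h) m)]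
      exact S.usedPower_le (hz.admissible h) m)

theorem Feasible.integrable_activity_mul_primaryRate [IsFiniteMeasure ν] (hz : S.Feasible ν z)
    (k : Fin K) : Integrable (fun h => activity h k * S.primaryRate h (z h) k) ν :=
  Integrable.of_bound
    ((measurable_activity k).mul (hz.measurable_primaryRate k)).aestronglyMeasurable (S.ratePU k 0)
    (Eventually.of_forall fun h => by
      have h0 := S.primaryRate_nonneg (hz.admissible h) k
      rw [Real.norm_eq_abs, abs_of_nonneg (mul_nonneg (activity_nonneg h k) h0)]
      exact (mul_le_of_le_one_left h0 (activity_le_one h k)).trans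
        (S.primaryRate_le (hz.admissible h) k))

theorem Feasible.integrable_weightedRate (hz : S.Feasible ν z)
    (hcap : ∀ k m, Integrable (fun c => rateSU (gainSU c k m * S.peak c k m)) ν) :
    Integrable (fun h => S.weightedRate h (z h)) ν :=
  (S.integrable_peakRate hcap).mono' hz.measurable_weightedRate.aestronglyMeasurable
    (Eventually.of_forall fun h => by
      rw [Real.norm_eq_abs, abs_of_nonneg (S.weightedRate_nonneg (hz.admissible h))]
      exact S.weightedRate_le_peakRate (hz.admissible h))

theorem Feasible.integrable_rate_loss [IsFiniteMeasure ν] (hz : S.Feasible ν z) (k : Fin K) :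
    Integrable (fun h => activity h k * (S.ratePU k 0 - S.primaryRate h (z h) k)) ν := by
  simp only [mul_sub]
  exact ((integrable_activity ν k).mul_const _).sub (hz.integrable_activity_mul_primaryRate k)

/-- Measured by the loss against the interference-free rate, the rate constraint becomes a budget on
a nonnegative consumption, like the other two. -/
theorem Feasible.integral_rate_loss_le [IsFiniteMeasure ν] (hz : S.Feasible ν z) (k : Fin K) :
    ∫ h, activity h k * (S.ratePU k 0 - S.primaryRate h (z h) k) ∂ν
      ≤ (∫ h, activity h k ∂ν) * (S.ratePU k 0 - S.minRate k) := by
  simp only [mul_sub]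
  rw [integral_sub ((integrable_activity ν k).mul_const _)
    (hz.integrable_activity_mul_primaryRate k), integral_mul_const]
  linarith [hz.avg_rate k]

theorem Feasible.rate_loss_nonneg (hz : S.Feasible ν z) (h : CSI K M) (k : Fin K) :
    0 ≤ activity h k * (S.ratePU k 0 - S.primaryRate h (z h) k) :=
  mul_nonneg (activity_nonneg h k) (sub_nonneg.2 (S.primaryRate_le (hz.admissible h) k))

theorem Feasible.activity_mul_interference_nonneg (hz : S.Feasible ν z) (h : CSI K M) (k : Fin K) :
    0 ≤ activity h k * interference h (z h) k :=
  mul_nonneg (activity_nonneg h k) (S.interference_nonneg (hz.admissible h) k)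

theorem Feasible.maxAvgPower_nonneg (hz : S.Feasible ν z) (m : Fin M) : 0 ≤ S.maxAvgPower m :=
  (integral_nonneg fun h => S.usedPower_nonneg (hz.admissible h) m).trans (hz.avg_power m)

theorem Feasible.ae_interf_budget_nonneg [IsFiniteMeasure ν] (hz : S.Feasible ν z) (k : Fin K) :
    ∀ᵐ h ∂ν, 0 ≤ activity h k * S.maxInterf k :=
  ae_nonneg_mul_of_integral_mul_nonneg (integrable_activity ν k) (fun h => activity_nonneg h k)
    ((integral_nonneg fun h => hz.activity_mul_interference_nonneg h k).trans (hz.avg_interf k))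

theorem Feasible.ae_rate_budget_nonneg [IsFiniteMeasure ν] (hz : S.Feasible ν z) (k : Fin K) :
    ∀ᵐ h ∂ν, 0 ≤ activity h k * (S.ratePU k 0 - S.minRate k) :=
  ae_nonneg_mul_of_integral_mul_nonneg (integrable_activity ν k) (fun h => activity_nonneg h k)
    ((integral_nonneg fun h => hz.rate_loss_nonneg h k).trans (hz.integral_rate_loss_le k))

end Feasible

/-! ### Long-term guarantees for the runs. -/

section Runs

variable {S} {Ω : Type*} [MeasurableSpace Ω] {μ : Measure Ω} {h : ℕ → Ω → CSI K M}

variable (S μ h) in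
/-- Every run with bounded updates and largest stepsize `η` loses asymptotically at most `d` with
respect to the optimal value. -/
def SumRateLossLe (G η d : ℝ) : Prop :=
  ∀ ηπ ηθ ηρ : ℝ, 0 < ηπ → 0 < ηθ → 0 < ηρ → max ηπ (max ηθ ηρ) = η →
    ∀ (lam : ℕ → Ω → Multipliers K M) (x : ℕ → Ω → Allocation K M),
      (∀ᵐ ω ∂μ, S.IsStochasticRA ηπ ηθ ηρ (fun n => h n ω) (fun n => lam n ω)
        (fun n => x n ω)) →
      (∀ᵐ ω ∂μ, S.BoundedUpdates G (fun n => h n ω) (fun n => x n ω)) →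
      ∀ᵐ ω ∂μ, ∀ ε : ℝ, 0 < ε → ∀ᶠ n in atTop,
        S.optimalValue (μ.map (h 0)) - d - ε
          ≤ sampleAverage (fun l => S.weightedRate (h l ω) (x l ω)) n

theorem SumRateLossLe.mono {G η d d' : ℝ} (hd : SumRateLossLe S μ h G η d) (hdd' : d ≤ d') :
    SumRateLossLe S μ h G η d' := by
  intro ηπ ηθ ηρ hπ hθ hρ hη lam x hrun hbdd
  filter_upwards [hd ηπ ηθ ηρ hπ hθ hρ hη lam x hrun hbdd] with ω hω ε hε
  filter_upwards [hω ε hε] with n hn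
  linarith

/-- Rates are nonnegative, so a finite loss is admissible for every stepsize; the infimum defining Δ
is over a nonempty set. -/
theorem sumRateLossLe_abs_optimalValue (G η : ℝ) :
    SumRateLossLe S μ h G η |S.optimalValue (μ.map (h 0))| := by
  intro ηπ ηθ ηρ hπ hθ hρ hη lam x hrun hbdd
  filter_upwards [hrun] with ω run ε hε
  refine Eventually.of_forall fun n => ?_
  have h1 : 0 ≤ sampleAverage (fun l => S.weightedRate (h l ω) (x l ω)) n :=
    div_nonneg (Finset.sum_nonneg fun l _ => S.weightedRate_nonneg (run.allocation l).admissible)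
      n.cast_nonneg
  linarith [le_abs_self (S.optimalValue (μ.map (h 0)))]

variable [IsProbabilityMeasure μ]

/-- The allocations of the stochastic dual iterations satisfy the long-term constraints. -/
theorem ae_eventually_longTerm_constraints (hmeas : ∀ n, Measurable (h n))
    (hstat : IsStationaryErgodic μ h)
    (hcap : ∀ k m, Integrable (fun c => rateSU (gainSU c k m * S.peak c k m)) (μ.map (h 0)))
    (hfeas : ∃ z, S.Feasible (μ.map (h 0)) z) {ηπ ηθ ηρ G : ℝ} (hπ : 0 < ηπ) (hθ : 0 < ηθ)
    (hρ : 0 < ηρ) {lam : ℕ → Ω → Multipliers K M} {x : ℕ → Ω → Allocation K M}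
    (hrun : ∀ᵐ ω ∂μ, S.IsStochasticRA ηπ ηθ ηρ (fun n => h n ω) (fun n => lam n ω)
      (fun n => x n ω))
    (hbdd : ∀ᵐ ω ∂μ, S.BoundedUpdates G (fun n => h n ω) (fun n => x n ω)) :
    ∀ᵐ ω ∂μ, ∀ ε : ℝ, 0 < ε →
      (∀ m, ∀ᶠ n in atTop, sampleAverage (fun l => usedPower (x l ω) m) n
        ≤ S.maxAvgPower m + ε) ∧
      (∀ k, ∀ᶠ n in atTop,
        sampleAverage (fun l => activity (h l ω) k * interference (h l ω) (x l ω) k) n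
        ≤ (∫ c, activity c k ∂(μ.map (h 0))) * S.maxInterf k + ε) ∧
      (∀ k, ∀ᶠ n in atTop, (∫ c, activity c k ∂(μ.map (h 0))) * S.minRate k - ε
        ≤ sampleAverage (fun l => activity (h l ω) k * S.primaryRate (h l ω) (x l ω) k) n) := by
  have := Measure.isProbabilityMeasure_map (μ := μ) (hmeas 0).aemeasurable
  obtain ⟨z, hz⟩ := hfeas
  have hI := ae_all_iff.2 fun k => hstat.ae_forall hmeas (hz.ae_interf_budget_nonneg k)
  have hr := ae_all_iff.2 fun k => hstat.ae_forall hmeas (hz.ae_rate_budget_nonneg k)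
  have hF := hstat.ae_tendsto_sampleAverage hmeas S.measurable_peakRate (S.integrable_peakRate hcap)
  have ha := ae_all_iff.2 fun k => hstat.ae_tendsto_sampleAverage hmeas
    (measurable_activity (M := M) k) (integrable_activity _ k)
  filter_upwards [hI, hr, hF, ha, hrun, hbdd] with ω hI hr hF ha run bdd ε hε
  obtain ⟨hlπ, hlθ, hlρ⟩ := run.tendsto_multipliers_div bdd hπ hθ hρ hz.maxAvgPower_nonneg
    (fun l k => hI k l) (fun l k => hr k l) hF
  refine ⟨fun m => ?_, fun k => ?_, fun k => ?_⟩
  · filter_upwards [eventually_neg_le_sampleAverage hπ (fun n => (run.nonneg n).pi m)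
      (fun n => run.pi_step n m) (hlπ m) hε, eventually_gt_atTop 0] with n hn hn0
    have hn0' : (n : ℝ) ≠ 0 := by exact_mod_cast hn0.ne'
    simp only [updatePi] at hn
    rw [sampleAverage_sub] at hn
    have h1 : sampleAverage (fun _ => S.maxAvgPower m) n = S.maxAvgPower m := by
      simp [sampleAverage, mul_div_cancel_left₀ _ hn0']
    linarith
  · have hlim := (ha k).const_mul (S.maxInterf k)
    filter_upwards [eventually_neg_le_sampleAverage hθ (fun n => (run.nonneg n).theta k)
      (fun n => run.theta_step n k) (hlθ k) (half_pos hε), hlim.eventually_lt_const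
        (lt_add_of_pos_right _ (half_pos hε))] with n hn hn'
    simp only [updateTheta, mul_sub] at hn
    rw [sampleAverage_sub] at hn
    simp only [mul_comm _ (S.maxInterf k)] at hn ⊢
    rw [sampleAverage_const_mul] at hn
    linarith
  · have hlim := (ha k).const_mul (S.minRate k)
    filter_upwards [eventually_neg_le_sampleAverage hρ (fun n => (run.nonneg n).rho k)
      (fun n => run.rho_step' n k) (hlρ k) (half_pos hε), hlim.eventually_const_lt
        (sub_lt_self _ (half_pos hε))] with n hn hn'
    simp only [updateRho, mul_sub, neg_sub] at hn
    rw [sampleAverage_sub] at hn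
    simp only [mul_comm _ (S.minRate k)] at hn ⊢
    rw [sampleAverage_const_mul] at hn
    linarith

/-- The duality terms of a feasible policy are asymptotically almost nonnegative on average when the
stepsizes are small. -/
theorem eventually_neg_le_sampleAverage_price (hmeas : ∀ n, Measurable (h n))
    (hstat : IsStationaryErgodic μ h) {z : CSI K M → Allocation K M}
    (hz : S.Feasible (μ.map (h 0)) z) {G δ : ℝ} (hG : 0 ≤ G) (hδ : 0 < δ) :
    ∀ᶠ η₀ in 𝓝[>] (0 : ℝ), ∀ᵐ ω ∂μ, ∀ ηπ ηθ ηρ, 0 < ηπ → 0 < ηθ → 0 < ηρ →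
      max ηπ (max ηθ ηρ) = η₀ → ∀ (lam : ℕ → Multipliers K M) (x : ℕ → Allocation K M),
        S.IsStochasticRA ηπ ηθ ηρ (fun n => h n ω) lam x →
        S.BoundedUpdates G (fun n => h n ω) x →
        ∀ᶠ n in atTop, -((M + 2 * K) * δ)
          ≤ sampleAverage (fun l => S.price (h l ω) (lam l) (z (h l ω))) n := by
  have := Measure.isProbabilityMeasure_map (μ := μ) (hmeas 0).aemeasurable
  have hb := S.sum_β_nonneg
  have eπ := fun m : Fin M => hstat.eventually_neg_le_sampleAverage_slack hmeas
    (ind := fun _ => 1) (c := fun c => usedPower (z c) m) (b := S.maxAvgPower m)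
    measurable_const (integrable_const _) (fun _ => zero_le_one) (hz.measurable_usedPower m)
    (hz.integrable_usedPower m) (fun c => S.usedPower_nonneg (hz.admissible c) m)
    (by simpa using hz.avg_power m) (C := K * (2 * S.β m))
    (mul_nonneg K.cast_nonneg (mul_nonneg zero_le_two (S.β_pos m).le)) hG hδ
  have eθ := fun k : Fin K => hstat.eventually_neg_le_sampleAverage_slack hmeas
    (ind := fun c => activity c k) (c := fun c => activity c k * interference c (z c) k)
    (b := S.maxInterf k) (measurable_activity k) (integrable_activity _ k)
    (fun c => activity_nonneg c k) ((measurable_activity k).mul (hz.measurable_interference k))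
    (hz.integrable_interf k) (fun c => hz.activity_mul_interference_nonneg c k) (hz.avg_interf k)
    (C := 2 * ∑ m, S.β m) (by positivity) hG hδ
  have eρ := fun k : Fin K => hstat.eventually_neg_le_sampleAverage_slack hmeas
    (ind := fun c => activity c k)
    (c := fun c => activity c k * (S.ratePU k 0 - S.primaryRate c (z c) k))
    (b := S.ratePU k 0 - S.minRate k) (measurable_activity k) (integrable_activity _ k)
    (fun c => activity_nonneg c k)
    ((measurable_activity k).mul ((hz.measurable_primaryRate k).const_sub _))
    (hz.integrable_rate_loss k) (fun c => hz.rate_loss_nonneg c k) (hz.integral_rate_loss_le k)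
    -- The bound `G` on the `theta` updates caps the interference at an active primary user by
    -- `|S.maxInterf k| + G`, the `X` of `rho_mul_rate_loss_le`.
    (C := 2 * (1 + (|S.maxInterf k| + G)) * ∑ m, S.β m) (by positivity) hG hδ
  filter_upwards [eventually_all.2 eπ, eventually_all.2 eθ, eventually_all.2 eρ]
    with η₀ eπ eθ eρ
  filter_upwards [ae_all_iff.2 eπ, ae_all_iff.2 eθ, ae_all_iff.2 eρ] with ω eπ eθ eρ
    ηπ ηθ ηρ hπ hθ hρ hη lam x run bdd
  have hlam := run.nonneg
  have aπ := fun m => eπ m ηπ η₀ hπ (hη ▸ le_max_left _ _) le_rfl (fun l => (lam l).pi m)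
    (fun l => S.updatePi (x l) m) (fun l => usedPower (x l) m) (fun l => (hlam l).pi m)
    (fun l => by rw [updatePi, mul_one]) (fun l => bdd.pi_bdd l m) (fun l => run.pi_step l m)
    (fun l => by rw [mul_one]; exact (run.allocation l).pi_mul_usedPower_le S (hlam l) m)
  have aθ := fun k => eθ k ηθ η₀ hθ (hη ▸ (le_max_left _ _).trans (le_max_right _ _)) le_rfl
    (fun l => (lam l).theta k) (fun l => S.updateTheta (h l ω) (x l) k)
    (fun l => activity (h l ω) k * interference (h l ω) (x l) k) (fun l => (hlam l).theta k)
    (fun l => by rw [updateTheta]; ring) (fun l => bdd.theta_bdd l k) (fun l => run.theta_step l k)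
    (fun l => (run.allocation l).theta_mul_interference_le S (hlam l) k)
  have aρ := fun k => eρ k ηρ η₀ hρ (hη ▸ (le_max_right _ _).trans (le_max_right _ _)) le_rfl
    (fun l => (lam l).rho k) (fun l => -S.updateRho (h l ω) (x l) k)
    (fun l => activity (h l ω) k * (S.ratePU k 0 - S.primaryRate (h l ω) (x l) k))
    (fun l => (hlam l).rho k) (fun l => by rw [updateRho]; ring)
    (fun l => by rw [abs_neg]; exact bdd.rho_bdd l k) (fun l => run.rho_step' l k)
    (fun l => (run.allocation l).rho_mul_rate_loss_le S (hlam l) k (by positivity) (by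
      have h1 := (neg_le_abs _).trans (bdd.theta_bdd l k)
      have h2 : activity (h l ω) k * S.maxInterf k ≤ |S.maxInterf k| :=
        (mul_le_mul_of_nonneg_left (le_abs_self _) (activity_nonneg _ k)).trans
          (mul_le_of_le_one_left (abs_nonneg _) (activity_le_one _ k))
      rw [updateTheta] at h1
      linarith))
  filter_upwards [eventually_all.2 aπ, eventually_all.2 aθ, eventually_all.2 aρ] with n aπ aθ aρ
  have hprice : sampleAverage (fun l => S.price (h l ω) (lam l) (z (h l ω))) n
      = ∑ m, sampleAverage (fun l => (lam l).pi m
          * (S.maxAvgPower m * 1 - usedPower (z (h l ω)) m)) n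
        + ∑ k, sampleAverage (fun l => (lam l).theta k * (S.maxInterf k * activity (h l ω) k
          - activity (h l ω) k * interference (h l ω) (z (h l ω)) k)) n
        + ∑ k, sampleAverage (fun l => (lam l).rho k
          * ((S.ratePU k 0 - S.minRate k) * activity (h l ω) k
          - activity (h l ω) k * (S.ratePU k 0 - S.primaryRate (h l ω) (z (h l ω)) k))) n := by
    rw [← sampleAverage_sum, ← sampleAverage_sum, ← sampleAverage_sum, ← sampleAverage_add,
      ← sampleAverage_add]
    congr 1
    ext l
    rw [price, sub_eq_add_neg, ← Finset.sum_neg_distrib]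
    congr 1
    · congr 1
      · refine Finset.sum_congr rfl fun m _ => ?_
        rw [updatePi, mul_one]
      · refine Finset.sum_congr rfl fun k _ => ?_
        rw [updateTheta]
        ring
    · refine Finset.sum_congr rfl fun k _ => ?_
      rw [updateRho]
      ring
  have sπ := Finset.sum_le_sum fun m (_ : m ∈ Finset.univ) => aπ m
  have sθ := Finset.sum_le_sum fun k (_ : k ∈ Finset.univ) => aθ k
  have sρ := Finset.sum_le_sum fun k (_ : k ∈ Finset.univ) => aρ k
  simp only [Finset.sum_const, Finset.card_univ, Fintype.card_fin, nsmul_eq_mul] at sπ sθ sρ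
  rw [hprice]
  linarith

/-- The loss with respect to the optimal value vanishes with the stepsizes. -/
theorem eventually_sumRateLossLe (hmeas : ∀ n, Measurable (h n)) (hstat : IsStationaryErgodic μ h)
    (hcap : ∀ k m, Integrable (fun c => rateSU (gainSU c k m * S.peak c k m)) (μ.map (h 0)))
    (hfeas : ∃ z, S.Feasible (μ.map (h 0)) z) (G : ℝ) {δ : ℝ} (hδ : 0 < δ) :
    ∀ᶠ η in 𝓝[>] (0 : ℝ), SumRateLossLe S μ h G η δ := by
  obtain ⟨z₀, hz₀⟩ := hfeas
  -- The loss `δ` splits into thirds: suboptimality of `z`, the quadratic step term, and the price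
  -- of `z`. The initial energy over `n` and the fluctuation of the rate of `z` go into `ε`.
  obtain ⟨_, ⟨z, hz, rfl⟩, hopt⟩ := exists_lt_of_lt_csSup
    (s := {c | ∃ z, S.Feasible (μ.map (h 0)) z ∧ c = ∫ c, S.weightedRate c (z c) ∂(μ.map (h 0))})
    ⟨_, z₀, hz₀, rfl⟩ (sub_lt_self (S.optimalValue (μ.map (h 0))) (by positivity : 0 < δ / 3))
  have hsmall : ∀ᶠ η in 𝓝[>] (0 : ℝ), (M + 2 * K) * (η * G ^ 2 / 2) < δ / 3 := by
    have hcont : Continuous fun η : ℝ => ((M : ℝ) + 2 * K) * (η * G ^ 2 / 2) := by fun_prop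
    have h1 : Tendsto (fun η : ℝ => ((M : ℝ) + 2 * K) * (η * G ^ 2 / 2)) (𝓝[>] 0) (𝓝 0) := by
      simpa using (hcont.tendsto 0).mono_left nhdsWithin_le_nhds
    exact h1.eventually_lt_const (by positivity)
  have hδ' : 0 < δ / (3 * (M + 2 * K + 1)) := by positivity
  have hprice_le : (M + 2 * K) * (δ / (3 * (M + 2 * K + 1))) ≤ δ / 3 := by
    rw [← mul_div_assoc, div_le_div_iff₀ (by positivity) (by positivity)]
    linarith
  filter_upwards [hsmall, eventually_neg_le_sampleAverage_price hmeas hstat hz (abs_nonneg G) hδ']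
    with η hη hprice
  intro ηπ ηθ ηρ hπ hθ hρ hmax lam x hrun hbdd
  filter_upwards [hprice, hrun, hbdd, hstat.ae_tendsto_sampleAverage hmeas
    hz.measurable_weightedRate (hz.integrable_weightedRate hcap)] with ω hprice run bdd hlim ε hε
  have bdd' : S.BoundedUpdates |G| (fun n => h n ω) (fun n => x n ω) :=
    ⟨fun n m => (bdd.pi_bdd n m).trans (le_abs_self G),
      fun n k => (bdd.theta_bdd n k).trans (le_abs_self G),
      fun n k => (bdd.rho_bdd n k).trans (le_abs_self G)⟩
  have hE := tendsto_const_div_atTop_nhds_zero_nat (energy ηπ ηθ ηρ (lam 0 ω))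
  filter_upwards [hprice ηπ ηθ ηρ hπ hθ hρ hmax _ _ run bdd',
    hlim.eventually_const_lt (sub_lt_self _ (half_pos hε)),
    hE.eventually_lt_const (half_pos hε), eventually_gt_atTop 0] with n h1 h2 h3 hn0
  have hn0' : (0 : ℝ) < n := by exact_mod_cast hn0
  have h4 := run.energy_add_sum_le bdd hπ hθ hρ (η := η) (hmax ▸ le_max_left _ _)
    (hmax ▸ (le_max_left _ _).trans (le_max_right _ _))
    (hmax ▸ (le_max_right _ _).trans (le_max_right _ _))
    (y := fun l => z (h l ω)) (fun l => hz.admissible _) n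
  have h5 : sampleAverage (fun l => S.weightedRate (h l ω) (z (h l ω))) n
      + sampleAverage (fun l => S.price (h l ω) (lam l ω) (z (h l ω))) n
      ≤ energy ηπ ηθ ηρ (lam 0 ω) / n + sampleAverage (fun l => S.weightedRate (h l ω) (x l ω)) n
        + (M + 2 * K) * (η * G ^ 2 / 2) := by
    have h6 := energy_nonneg hπ hθ hρ (lam n ω)
    simp only [sampleAverage]
    rw [← add_div, ← add_div, div_add' _ _ _ hn0'.ne']
    refine div_le_div_of_nonneg_right ?_ hn0'.le
    linarith
  linarith

end Runs

end Network

end CognitiveRadio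

theorem proposition1 {K M : ℕ} (S : CognitiveRadio.Network K M)
    {Ω : Type*} [MeasurableSpace Ω] (μ : Measure Ω) [IsProbabilityMeasure μ]
    (h : ℕ → Ω → CognitiveRadio.CSI K M)
    (hmeas : ∀ n, Measurable (h n))
    (hstat : CognitiveRadio.IsStationaryErgodic μ h)
    -- the ergodic capacities at peak power are finite
    (hcap : ∀ k m, Integrable (fun c : CognitiveRadio.CSI K M =>
      CognitiveRadio.rateSU (CognitiveRadio.gainSU c k m * S.peak c k m)) (μ.map (h 0)))
    -- the resource allocation problem is feasible
    (hfeas : ∃ z, S.Feasible (μ.map (h 0)) z)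
    -- a bound on the updates, common to all stepsizes
    (G : ℝ) :
    ∃ Δ : ℝ → ℝ, Tendsto Δ (𝓝[>] 0) (𝓝 0) ∧
      ∀ ηπ ηθ ηρ : ℝ, 0 < ηπ → 0 < ηθ → 0 < ηρ →
      ∀ (lam : ℕ → Ω → CognitiveRadio.Multipliers K M)
        (x : ℕ → Ω → CognitiveRadio.Allocation K M),
        (∀ᵐ ω ∂μ, S.IsStochasticRA ηπ ηθ ηρ
          (fun n => h n ω) (fun n => lam n ω) (fun n => x n ω)) →
        (∀ᵐ ω ∂μ, S.BoundedUpdates G (fun n => h n ω) (fun n => x n ω)) →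
        ∀ᵐ ω ∂μ, ∀ ε : ℝ, 0 < ε →
          -- long-term power of the secondary users
          (∀ m, ∀ᶠ n in atTop,
            CognitiveRadio.sampleAverage
              (fun l => CognitiveRadio.Network.usedPower (x l ω) m) n
            ≤ S.maxAvgPower m + ε) ∧
          -- long-term interference power at the primary users
          (∀ k, ∀ᶠ n in atTop,
            CognitiveRadio.sampleAverage
              (fun l => CognitiveRadio.activity (h l ω) k *
                CognitiveRadio.Network.interference (h l ω) (x l ω) k) n
            ≤ (∫ c, CognitiveRadio.activity c k ∂(μ.map (h 0))) * S.maxInterf k + ε) ∧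
          -- long-term rate of the primary users
          (∀ k, ∀ᶠ n in atTop,
            (∫ c, CognitiveRadio.activity c k ∂(μ.map (h 0))) * S.minRate k - ε
            ≤ CognitiveRadio.sampleAverage
              (fun l => CognitiveRadio.activity (h l ω) k *
                S.primaryRate (h l ω) (x l ω) k) n) ∧
          -- weighted sum-capacity of the secondary users
          (∀ᶠ n in atTop,
            S.optimalValue (μ.map (h 0)) - Δ (max ηπ (max ηθ ηρ)) - ε
            ≤ CognitiveRadio.sampleAverage (fun l => S.weightedRate (h l ω) (x l ω)) n) := by
  -- Δ is the infimum of the losses admissible for all runs with largest stepsize `η`, plus `η`: the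
  -- infimum need not be attained, and the positive extra term leaves room for an admissible loss.
  set D : ℝ → Set ℝ := fun η => {d | 0 ≤ d ∧ CognitiveRadio.Network.SumRateLossLe S μ h G η d}
  have hne : ∀ η, (D η).Nonempty := fun η =>
    ⟨_, abs_nonneg _, CognitiveRadio.Network.sumRateLossLe_abs_optimalValue G η⟩
  have hbdd : ∀ η, BddBelow (D η) := fun η => ⟨0, fun d hd => hd.1⟩
  refine ⟨fun η => sInf (D η) + η, ?_, ?_⟩
  · have h1 : Tendsto (fun η => sInf (D η)) (𝓝[>] 0) (𝓝 0) := by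
      rw [Metric.tendsto_nhds]
      intro ε hε
      filter_upwards [CognitiveRadio.Network.eventually_sumRateLossLe hmeas hstat hcap hfeas G
        (half_pos hε)] with η hη
      have h2 : 0 ≤ sInf (D η) := le_csInf (hne η) fun d hd => hd.1
      have h3 : sInf (D η) ≤ ε / 2 := csInf_le (hbdd η) ⟨(half_pos hε).le, hη⟩
      rw [Real.dist_0_eq_abs, abs_of_nonneg h2]
      linarith
    have h2 : Tendsto (fun η : ℝ => η) (𝓝[>] 0) (𝓝 0) := tendsto_id.mono_left nhdsWithin_le_nhds
    simpa using h1.add h2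
  · intro ηπ ηθ ηρ hπ hθ hρ lam x hrun hbd
    have hη : 0 < max ηπ (max ηθ ηρ) := lt_max_of_lt_left hπ
    obtain ⟨d, hd, hdlt⟩ := exists_lt_of_csInf_lt (hne (max ηπ (max ηθ ηρ)))
      (lt_add_of_pos_right (sInf (D (max ηπ (max ηθ ηρ)))) hη)
    filter_upwards [CognitiveRadio.Network.ae_eventually_longTerm_constraints hmeas hstat hcap hfeas
      hπ hθ hρ hrun hbd, hd.2.mono hdlt.le ηπ ηθ ηρ hπ hθ hρ rfl lam x hrun hbd] with ω h1 h2 ε hε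
    obtain ⟨c1, c2, c3⟩ := h1 ε hε
    exact ⟨c1, c2, c3, h2 ε hε⟩
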